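/- **Conventions.** A quandle is a set $X$ with an operation $*$ such that $x*x=x$; for all $x,y$ there is a unique $z$ with $z*y=x$; and $(x*y)*z=(x*z)*(y*z)$. For an abelian group $A$ (written multiplicatively), a $2$-cocycle is a map $\phi:X\times X\to A$ with $\phi(x,z)\,\phi(x*z,y*z)=\phi(x*y,z)\,\phi(x,y)$ and $\phi(x,x)=1$ for all $x,y,z\in X$. Oriented virtual link diagrams are given by their Gauss diagrams: $n$ oriented circles with signed arrows, one for each classical crossing, pointing from the over-crossing passage to the under-crossing passage (virtual crossings are not recorded). Two of them are equivalent if they are related by a finite sequence of orientation-preserving homeomorphisms of the circles (which may permute the circles) and Reidemeister moves, in all oriented versions; detour moves do not change the Gauss diagram. An arc of $D$ is a path along $D$ from one under-crossing to the next (or a whole component without under-crossings). The fundamental quandle $Q(D)$ is generated by the arcs of $D$, with one relation for each classical crossing with over-crossing arc $y$, incoming under-crossing arc $a$ and outgoing under-crossing arc $b$: $a*y=b$ if the crossing is positive, and $b*y=a$ if it is negative. A coloring of $D$ by $X$ is a quandle homomorphism $\chi:Q(D)\to X$. The Boltzmann weight of such a crossing $\tau$ is $B(\tau,\chi)=\phi(\chi(a),\chi(y))$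 if $\tau$ is positive and $B(\tau,\chi)=\phi(\chi(b),\chi(y))^{-1}$ if $\tau$ is negative. For finite $X$ put $$\Phi_X^\phi(D)=\sum_{\chi}\prod_{\tau}B(\tau,\chi)\in\mathbb{Z}[A],$$ where $\chi$ runs over all colorings of $D$ by $X$ and $\tau$ over all classical crossings of $D$. The diagram $\mathrm{Zh}(D)=D\cup\omega$ is obtained from $D$ by adding one component $\omega$ as follows. At each classical crossing of $D$, drawn with both strands directed upwards, choose the left or the right side; on that side, draw two arcs of $\omega$, directed upwards, one passing over the incoming strand and one passing over the outgoing strand. Then connect all these arcs, in any order, to a single closed component $\omega$, all further crossings being virtual. **Theorem.** Let $X$ be a finite quandle, $A$ an abelian group and $\phi:X\times X\to A$ a $2$-cocycle. 1. If $D_0$ and $D_1$ are equivalent virtual link diagrams, then $$\Phi_X^\phi(\mathrm{Zh}(D_0))=\Phi_X^\phi(\mathrm{Zh}(D_1)),$$ whatever choices are made in the construction of $\mathrm{Zh}(D_0)$ and $\mathrm{Zh}(D_1)$. That is, the extended cocycle invariant $\widetilde\Phi_X^\phi(D)=\Phi_X^\phi(\mathrm{Zh}(D))$ is a well-defined invariant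 of the virtual link represented by $D$. 2. Let $L$ be a virtual link diagram with a distinguished component $\omega$, and let $L'$ be obtained from $L$ by an $\omega$-over-crossings-commute ($\omega$OCC) move, which exchanges two consecutive over-crossings along $\omega$. Then there is a bijection $\chi\mapsto\chi'$ from the colorings of $L$ by $X$ to the colorings of $L'$ by $X$ such that $B(\tau,\chi')=B(\tau,\chi)$ for every classical crossing $\tau$ (the crossings of $L$ and $L'$ being identified); in particular $\prod_\tau B(\tau,\chi')=\prod_\tau B(\tau,\chi)$. -/

import Mathlib

open scoped Quandles

/-! ### Gauss diagrams of oriented virtual links -/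

/-- An (oriented) virtual link diagram with `n` components, given by its Gauss diagram.

`Arrow` is the set of arrows, i.e. of classical crossings, and `sign` records the crossing signs.
A letter `(c, true)` is the tail of the arrow `c`, where the crossing `c` is passed along the
over-crossing strand; `(c, false)` is the head of `c`, where it is passed along the under-crossing
strand. The word `words i` lists the arrow endpoints met along the `i`-th oriented circle, starting
at some base point, and is read cyclically. Each endpoint of each arrow occurs exactly once.
Virtual crossings are not recorded. -/
structure GaussDiagram (n : ℕ) where
  Arrow : Type
  [fintypeArrow : Fintype Arrow]
  [decEqArrow : DecidableEq Arrow]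
  sign : Arrow → ℤˣ
  words : Fin n → List (Arrow × Bool)
  valid : ∀ e : Arrow × Bool, ∑ i, (words i).countP (· = e) = 1

attribute [instance] GaussDiagram.fintypeArrow GaussDiagram.decEqArrow

/-- A Gauss diagram of `k` oriented strands: the same data, with the words read linearly. It
describes the part of a link diagram inside a disc that meets the diagram in `k` strands. -/
structure GaussTangle (k : ℕ) where
  Arrow : Type
  [fintypeArrow : Fintype Arrow]
  [decEqArrow : DecidableEq Arrow]
  sign : Arrow → ℤˣ
  strands : Fin k → List (Arrow × Bool)
  valid : ∀ e : Arrow × Bool, ∑ j, (strands j).countP (· = e) = 1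

attribute [instance] GaussTangle.fintypeArrow GaussTangle.decEqArrow

/-- The exterior of a disc meeting a link diagram in `k` strands: a Gauss diagram with `k` slots on
its circles (letters `Sum.inr j`), at which the strands of a tangle are to be inserted. -/
structure GaussTemplate (n k : ℕ) where
  Arrow : Type
  [fintypeArrow : Fintype Arrow]
  [decEqArrow : DecidableEq Arrow]
  sign : Arrow → ℤˣ
  words : Fin n → List ((Arrow × Bool) ⊕ Fin k)
  valid : ∀ e : (Arrow × Bool) ⊕ Fin k, ∑ i, (words i).countP (· = e) = 1

attribute [instance] GaussTemplate.fintypeArrow GaussTemplate.decEqArrow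

namespace GaussTemplate

variable {n k : ℕ}

/-- What is written in place of a letter of the template when the tangle `S` is inserted. -/
def fill (T : GaussTemplate n k) (S : GaussTangle k) :
    (T.Arrow × Bool) ⊕ Fin k → List ((T.Arrow ⊕ S.Arrow) × Bool)
  | .inl e => [(Sum.inl e.1, e.2)]
  | .inr j => (S.strands j).map fun e => (Sum.inr e.1, e.2)

theorem count_fill_inl (T : GaussTemplate n k) (S : GaussTangle k) (c : T.Arrow) (b : Bool)
    (l : List ((T.Arrow × Bool) ⊕ Fin k)) :
    (l.flatMap (T.fill S)).countP (· = (Sum.inl c, b)) = l.countP (· = Sum.inl (c, b)) := by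
  induction l with
  | nil => simp
  | cons a l ih =>
    rw [List.flatMap_cons, List.countP_append, ih, List.countP_cons, add_comm]
    congr 1
    rcases a with ⟨c', b'⟩ | j
    · simp [fill, List.countP_cons]
    · simp [fill, List.countP_map, List.countP_eq_zero]

theorem count_fill_inr (T : GaussTemplate n k) (S : GaussTangle k) (c : S.Arrow) (b : Bool)
    (l : List ((T.Arrow × Bool) ⊕ Fin k)) :
    (l.flatMap (T.fill S)).countP (· = (Sum.inr c, b)) =
      ∑ j, l.countP (· = Sum.inr j) * (S.strands j).countP (· = (c, b)) := by
  induction l with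
  | nil => simp
  | cons a l ih =>
    rw [List.flatMap_cons, List.countP_append, ih]
    rcases a with ⟨c', b'⟩ | j
    · simp [fill]
    · simp [fill, List.countP_map, List.countP_cons, add_mul, Finset.sum_add_distrib, add_comm,
        ite_mul, Function.comp_def, Prod.ext_iff]

/-- The Gauss diagram obtained by inserting the tangle `S` into the slots of the template `T`. -/
def plug (T : GaussTemplate n k) (S : GaussTangle k) : GaussDiagram n where
  Arrow := T.Arrow ⊕ S.Arrow
  sign := Sum.elim T.sign S.sign
  words i := (T.words i).flatMap (T.fill S)
  valid := by
    rintro ⟨c | c, b⟩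
    · simp only [count_fill_inl]
      exact T.valid _
    · simp only [count_fill_inr]
      rw [Finset.sum_comm]
      simp only [← Finset.sum_mul, T.valid, one_mul]
      exact S.valid _

end GaussTemplate

namespace GaussTangle

/-- `k` strands without crossings. -/
def trivial (k : ℕ) : GaussTangle k where
  Arrow := Empty
  sign := Empty.elim
  strands _ := []
  valid e := e.1.elim

/-- A kink with a crossing of sign `ε`, first passed along the over-crossing strand iff
`overFirst`. -/
def kink (ε : ℤˣ) (overFirst : Bool) : GaussTangle 1 where
  Arrow := Unit
  sign _ := ε
  strands _ := [((), overFirst), ((), !overFirst)]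
  valid := by revert overFirst; decide

/-- Strand `0` passes over strand `1` at two consecutive crossings of opposite signs `ε, -ε`. The
two strands run in the same direction if `parallel`, in opposite directions otherwise. -/
def bigon (ε : ℤˣ) (parallel : Bool) : GaussTangle 2 where
  Arrow := Fin 2
  sign := ![ε, -ε]
  strands := ![[(0, true), (1, true)],
    if parallel then [(0, false), (1, false)] else [(1, false), (0, false)]]
  valid := by revert parallel; decide

/-- A word, reversed if the orientation `o` is `-1`. -/
def orient {α : Type} (o : ℤˣ) (l : List α) : List α := if o = 1 then l else l.reverse

/-- Three strands, pairwise crossing once: the top strand `0`, the middle strand `1` and the bottom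
strand `2`. Crossing `0` is top over middle, crossing `1` is top over bottom, and crossing `2` is
middle over bottom. The orientation `o j = 1` means that the strand `j` passes its two crossings in
increasing order. Drawn in the plane, the three strands bound a triangle exactly if the sign of each
crossing is the orientation of the strand not involved in it, times a common factor `s`. -/
def triangle (s : ℤˣ) (o : Fin 3 → ℤˣ) : GaussTangle 3 where
  Arrow := Fin 3
  sign := ![s * o 2, s * o 1, s * o 0]
  strands := ![orient (o 0) [(0, true), (1, true)],
    orient (o 1) [(0, false), (2, true)],
    orient (o 2) [(1, false), (2, false)]]
  valid := by
    generalize o 0 = a, o 1 = b, o 2 = c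
    revert a b c
    decide

/-- One strand that passes over at two consecutive crossings with signs `ε 0, ε 1`, in the order
`0, 1` (or `1, 0` if `swap`); the under-crossing strands are strands `1` and `2`. -/
def overPair (ε : Fin 2 → ℤˣ) (swap : Bool) : GaussTangle 3 where
  Arrow := Fin 2
  sign := ε
  strands := ![if swap then [(1, true), (0, true)] else [(0, true), (1, true)],
    [(0, false)], [(1, false)]]
  valid := by revert swap; decide

end GaussTangle

namespace GaussDiagram

variable {n : ℕ}

/-- Equality of Gauss diagrams up to orientation-preserving diffeomorphisms of the circles: a
renaming of the arrows, a change of base points and a permutation of the components. -/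
def Iso (D D' : GaussDiagram n) : Prop :=
  ∃ (f : D.Arrow ≃ D'.Arrow) (π : Equiv.Perm (Fin n)), (∀ c, D'.sign (f c) = D.sign c) ∧
    ∀ i, ((D.words i).map fun e => (f e.1, e.2)).IsRotated (D'.words (π i))

/-- The moves of virtual knot theory on Gauss diagrams: isomorphisms and all oriented versions of
the three Reidemeister moves. (Planar isotopies and detour moves do not change the Gauss diagram.)
In the third Reidemeister move the signs of the crossings persist, and each of the three strands
passes its two crossings in the opposite order. -/
inductive Move : GaussDiagram n → GaussDiagram n → Prop
  | iso {D D' : GaussDiagram n} (h : Iso D D') : Move D D'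
  | omega1 (T : GaussTemplate n 1) (ε : ℤˣ) (overFirst : Bool) :
      Move (T.plug (.kink ε overFirst)) (T.plug (.trivial 1))
  | omega2 (T : GaussTemplate n 2) (ε : ℤˣ) (parallel : Bool) :
      Move (T.plug (.bigon ε parallel)) (T.plug (.trivial 2))
  | omega3 (T : GaussTemplate n 3) (s : ℤˣ) (o : Fin 3 → ℤˣ) :
      Move (T.plug (.triangle s o)) (T.plug (.triangle (-s) (-o)))

/-- Virtual Reidemeister equivalence. -/
def VirtualEquiv : GaussDiagram n → GaussDiagram n → Prop := Relation.EqvGen Move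

/-! ### The Zh-construction -/

/-- A letter `e` of a diagram stands for one of the two strands at a classical crossing. With both
strands of the crossing directed upwards, this says that the strand runs from the lower left to the
upper right: it is the over-crossing strand of a positive crossing or the under-crossing strand of a
negative one. -/
def leftToRight (D : GaussDiagram n) (e : D.Arrow × Bool) : Bool :=
  e.2 == decide (D.sign e.1 = 1)

/-- The base components near a crossing of `D` after `ω` has been added. At each crossing, directed
upwards, one arc of `ω` is drawn over the incoming strand and one over the outgoing strand on the
left side of the crossing (if `left` holds there), or on the right side (otherwise); the arcs of `ω`
are directed upwards. Hence each strand `e` of each crossing is crossed once by `ω`, at a new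
crossing named `e`. It comes before the crossing of `D` if the strand starts on the chosen side, and
after it if the strand ends there. -/
def zhLetter (D : GaussDiagram n) (left : D.Arrow → Bool) (e : D.Arrow × Bool) :
    List ((D.Arrow ⊕ D.Arrow × Bool) × Bool) :=
  if D.leftToRight e = left e.1 then [(Sum.inr e, false), (Sum.inl e.1, e.2)]
  else [(Sum.inl e.1, e.2), (Sum.inr e, false)]

theorem count_zhLetter_inl (D : GaussDiagram n) (left : D.Arrow → Bool) (c : D.Arrow) (b : Bool)
    (l : List (D.Arrow × Bool)) :
    (l.flatMap (D.zhLetter left)).countP (· = (Sum.inl c, b)) = l.countP (· = (c, b)) := by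
  induction l with
  | nil => simp
  | cons a l ih =>
    rw [List.flatMap_cons, List.countP_append, ih, List.countP_cons, add_comm]
    congr 1
    unfold zhLetter
    split_ifs <;> simp_all [Prod.ext_iff]

theorem count_zhLetter_inr (D : GaussDiagram n) (left : D.Arrow → Bool) (e : D.Arrow × Bool)
    (b : Bool) (l : List (D.Arrow × Bool)) :
    (l.flatMap (D.zhLetter left)).countP (· = (Sum.inr e, b)) =
      if b then 0 else l.countP (· = e) := by
  induction l with
  | nil => simp
  | cons a l ih =>
    rw [List.flatMap_cons, List.countP_append, ih, List.countP_cons, add_comm]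
    unfold zhLetter
    cases b <;> split_ifs <;> simp_all

/-- The diagram `Zh(D) = D ∪ ω`. The last component is `ω`; all of its classical crossings are
over-crossings with the base components. The sign of the crossing of `ω` with a strand is `-1` if
the strand runs from left to right and `1` otherwise. The construction depends on two choices: the
side `left` of each crossing on which `ω` is drawn, and the order `ord` in which the arcs of `ω` are
connected. -/
def zh (D : GaussDiagram n) (left : D.Arrow → Bool) (ord : List (D.Arrow × Bool))
    (hord : ∀ e, ord.countP (· = e) = 1) : GaussDiagram (n + 1) where
  Arrow := D.Arrow ⊕ D.Arrow × Bool
  sign := Sum.elim D.sign fun e => if D.leftToRight e then -1 else 1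
  words := Fin.snoc (α := fun _ => List ((D.Arrow ⊕ D.Arrow × Bool) × Bool))
    (fun i => (D.words i).flatMap (D.zhLetter left)) (ord.map fun e => (Sum.inr e, true))
  valid := by
    rintro ⟨c | e, b⟩
    · rw [Fin.sum_univ_castSucc]
      simp only [Fin.snoc_castSucc, Fin.snoc_last, count_zhLetter_inl, D.valid]
      simp [List.countP_map, List.countP_eq_zero]
    · rw [Fin.sum_univ_castSucc]
      simp only [Fin.snoc_castSucc, Fin.snoc_last, count_zhLetter_inr]
      cases b
      · simp [D.valid, List.countP_map, List.countP_eq_zero]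
      · simpa [List.countP_map, Function.comp_def] using hord e

/-! ### Arcs -/

/-- A passage of a circle through a classical crossing. -/
abbrev Pos (D : GaussDiagram n) : Type := Σ i, Fin (D.words i).length

def letter (D : GaussDiagram n) (p : D.Pos) : D.Arrow × Bool := (D.words p.1).get p.2

theorem exists_pos (D : GaussDiagram n) (e : D.Arrow × Bool) : ∃ p : D.Pos, D.letter p = e := by
  have h : ∃ i, e ∈ D.words i := by
    by_contra! h
    have := D.valid e
    rw [Finset.sum_eq_zero] at this
    · exact zero_ne_one this
    · intro i _
      rw [List.countP_eq_zero]
      rintro a ha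
      simpa using fun hae : a = e => h i (hae ▸ ha)
  obtain ⟨i, hi⟩ := h
  obtain ⟨k, hk⟩ := List.get_of_mem hi
  exact ⟨⟨i, k⟩, hk⟩

/-- The (unique) place where the letter `e` occurs. -/
noncomputable def pos (D : GaussDiagram n) (e : D.Arrow × Bool) : D.Pos :=
  (D.exists_pos e).choose

/-- Short arcs: the paths from one arrow endpoint to the next along a circle, where a circle without
arrow endpoints is a single short arc. On the circle `i`, the short arc `k` ends at the `k`-th
letter. -/
abbrev ShortArc (D : GaussDiagram n) : Type := Σ i, Fin (max 1 (D.words i).length)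

/-- The short arc that enters the crossing at `p`. -/
def before (D : GaussDiagram n) (p : D.Pos) : D.ShortArc :=
  ⟨p.1, p.2, lt_of_lt_of_le p.2.isLt (le_max_right _ _)⟩

/-- The short arc that leaves the crossing at `p`. -/
def after (D : GaussDiagram n) (p : D.Pos) : D.ShortArc :=
  ⟨p.1, (p.2 + 1) % (D.words p.1).length,
    lt_of_lt_of_le (Nat.mod_lt _ (Nat.zero_lt_of_lt p.2.isLt)) (le_max_right _ _)⟩

/-- Arcs: the paths from one under-crossing to the next. They are the classes of short arcs for the
equivalence relation that identifies the two sides of each over-crossing passage. -/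
def Arc (D : GaussDiagram n) : Type :=
  Quot fun s t : D.ShortArc => ∃ p : D.Pos, (D.letter p).2 = true ∧ s = D.before p ∧ t = D.after p

instance (D : GaussDiagram n) : Finite D.Arc := inferInstanceAs (Finite (Quot _))

/-- The over-crossing arc of a crossing. -/
noncomputable def overArc (D : GaussDiagram n) (c : D.Arrow) : D.Arc :=
  Quot.mk _ (D.before (D.pos (c, true)))

/-- The incoming under-crossing arc of a crossing. -/
noncomputable def inArc (D : GaussDiagram n) (c : D.Arrow) : D.Arc :=
  Quot.mk _ (D.before (D.pos (c, false)))

/-- The outgoing under-crossing arc of a crossing. -/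
noncomputable def outArc (D : GaussDiagram n) (c : D.Arrow) : D.Arc :=
  Quot.mk _ (D.after (D.pos (c, false)))

end GaussDiagram

/-! ### Quandles given by generators and relations

We use Mathlib's quandles, whose operation `y ◃ x` is written `x * y` in the convention of right
quandles; thus `x * y = y ◃ x` and `y ◃⁻¹ x` is the unique `z` with `z * y = x`. -/

/-- Formal quandle expressions in the generators `α`. -/
inductive QuandleTerm (α : Type) : Type
  | of (a : α) : QuandleTerm α
  | act (x y : QuandleTerm α) : QuandleTerm α
  | invAct (x y : QuandleTerm α) : QuandleTerm α

/-- The congruence generated by the relations `r` and the quandle axioms. -/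
inductive QuandleTerm.Rel {α : Type} (r : QuandleTerm α → QuandleTerm α → Prop) :
    QuandleTerm α → QuandleTerm α → Prop
  | refl (x) : Rel r x x
  | symm {x y} : Rel r x y → Rel r y x
  | trans {x y z} : Rel r x y → Rel r y z → Rel r x z
  | of {x y} : r x y → Rel r x y
  | act {x x' y y'} : Rel r x x' → Rel r y y' → Rel r (.act x y) (.act x' y')
  | invAct {x x' y y'} : Rel r x x' → Rel r y y' → Rel r (.invAct x y) (.invAct x' y')
  | self_distrib (x y z) : Rel r (.act x (.act y z)) (.act (.act x y) (.act x z))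
  | left_inv (x y) : Rel r (.invAct x (.act x y)) y
  | right_inv (x y) : Rel r (.act x (.invAct x y)) y
  | fix (x) : Rel r (.act x x) x

/-- The quandle with generators `α` and relations `r`. -/
def PresentedQuandle {α : Type} (r : QuandleTerm α → QuandleTerm α → Prop) : Type :=
  Quot (QuandleTerm.Rel r)

namespace PresentedQuandle

variable {α : Type} {r : QuandleTerm α → QuandleTerm α → Prop}

def mk (x : QuandleTerm α) : PresentedQuandle r := Quot.mk _ x

def of (a : α) : PresentedQuandle r := mk (.of a)

instance : Quandle (PresentedQuandle r) where
  act := Quot.map₂ .act (fun x _ _ h => .act (.refl x) h) (fun _ _ y h => .act h (.refl y))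
  invAct := Quot.map₂ .invAct (fun x _ _ h => .invAct (.refl x) h)
    (fun _ _ y h => .invAct h (.refl y))
  self_distrib := by
    rintro ⟨x⟩ ⟨y⟩ ⟨z⟩
    exact Quot.sound (.self_distrib x y z)
  left_inv := by
    rintro ⟨x⟩ ⟨y⟩
    exact Quot.sound (.left_inv x y)
  right_inv := by
    rintro ⟨x⟩ ⟨y⟩
    exact Quot.sound (.right_inv x y)
  fix := by
    rintro ⟨x⟩
    exact Quot.sound (.fix x)

theorem mk_act (x y : QuandleTerm α) : (mk (.act x y) : PresentedQuandle r) = mk x ◃ mk y := rfl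

theorem mk_act_invAct (x y : QuandleTerm α) :
    (mk (.act x (.invAct x y)) : PresentedQuandle r) = mk y := Quot.sound (.right_inv x y)

theorem hom_ext {X : Type*} [Quandle X] {f g : PresentedQuandle r →◃ X}
    (h : ∀ a, f (of a) = g (of a)) : f = g := by
  have key : ∀ x : QuandleTerm α, f (mk x) = g (mk x) := by
    intro x
    induction x with
    | of a => exact h a
    | act x y hx hy =>
      rw [mk_act, f.map_act, g.map_act, hx, hy]
    | invAct x y hx hy =>
      rw [← Rack.left_cancel (f (mk x)), ← f.map_act, ← mk_act, mk_act_invAct, hy, hx, ← g.map_act,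
        ← mk_act, mk_act_invAct]
  refine DFunLike.ext _ _ ?_
  rintro ⟨x⟩
  exact key x

instance {X : Type*} [Quandle X] [Finite X] [Finite α] : Finite (PresentedQuandle r →◃ X) :=
  Finite.of_injective (fun f (a : α) => f (of a)) fun _ _ h => hom_ext (congrFun h)

end PresentedQuandle

/-! ### The fundamental quandle, colorings and cocycle invariants -/

namespace GaussDiagram

variable {n : ℕ}

/-- The crossing relations. With the over-crossing arc `y`, the incoming under-crossing arc `a` and
the outgoing under-crossing arc `b`, the relation is `a * y = b` at a positive crossing, and
`b * y = a` at a negative crossing. -/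
inductive CrossingRel (D : GaussDiagram n) : QuandleTerm D.Arc → QuandleTerm D.Arc → Prop
  | positive (c : D.Arrow) (hc : D.sign c = 1) :
      CrossingRel D (.act (.of (D.overArc c)) (.of (D.inArc c))) (.of (D.outArc c))
  | negative (c : D.Arrow) (hc : D.sign c = -1) :
      CrossingRel D (.act (.of (D.overArc c)) (.of (D.outArc c))) (.of (D.inArc c))

/-- The fundamental quandle, generated by the arcs, with one relation for each crossing. -/
abbrev FundamentalQuandle (D : GaussDiagram n) : Type := PresentedQuandle D.CrossingRel

/-- Colorings of `D` by the quandle `X`. -/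
abbrev Coloring (D : GaussDiagram n) (X : Type*) [Quandle X] : Type _ := D.FundamentalQuandle →◃ X

noncomputable instance (D : GaussDiagram n) (X : Type*) [Quandle X] [Finite X] :
    Fintype (D.Coloring X) := Fintype.ofFinite _

end GaussDiagram

/-- Quandle `2`-cocycles with values in the multiplicative abelian group `A`: with `x * y = y ◃ x`,
`φ(x, z) φ(x * z, y * z) = φ(x * y, z) φ(x, y)` and `φ(x, x) = 1`. -/
structure IsQuandleCocycle {X A : Type*} [Quandle X] [CommGroup A] (φ : X → X → A) : Prop where
  cocycle : ∀ x y z, φ x z * φ (z ◃ x) (z ◃ y) = φ (y ◃ x) z * φ x y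
  diag : ∀ x, φ x x = 1

namespace GaussDiagram

variable {n : ℕ} {X A : Type*} [Quandle X] [CommGroup A]

/-- The Boltzmann weight of a crossing `c` with over-crossing color `y`: `φ(x, y)` at a positive
crossing with incoming under-crossing color `x`, and `φ(x, y)⁻¹` at a negative crossing with
outgoing under-crossing color `x`. -/
noncomputable def boltzmannWeight (D : GaussDiagram n) (φ : X → X → A) (χ : D.Coloring X)
    (c : D.Arrow) : A :=
  if D.sign c = 1 then φ (χ (.of (D.inArc c))) (χ (.of (D.overArc c)))
  else (φ (χ (.of (D.outArc c))) (χ (.of (D.overArc c))))⁻¹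

/-- The cocycle counting invariant, an element of the group ring `ℤ[A]`. -/
noncomputable def cocycleInvariant [Finite X] (D : GaussDiagram n) (φ : X → X → A) :
    MonoidAlgebra ℤ A :=
  ∑ χ : D.Coloring X, MonoidAlgebra.of ℤ A (∏ c, D.boltzmannWeight φ χ c)

end GaussDiagram

/-! ### Words of matrices -/

namespace CyclicWords

/-! The cocycle invariant is a state sum. Index matrices over ℤ[A] by `X`, rows by incoming and
columns by outgoing colors. A passage under color `y` becomes a weighted permutation matrix, written
U_y^{±1} according to the crossing sign; a passage over becomes the projector P_y onto color `y`.
Summing over the over-crossing colors `y` the product of the traces along the circles gives the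
invariant (`GaussDiagram.cocycleInvariant_eq`). The quandle and cocycle axioms turn into matrix
identities: U_y U_x = U_x U_{x ◃ y}, P_y U_x = U_x P_{x ◃ y}, P_y U_y = P_y = U_y P_y, and the P_y
are orthogonal projectors with sum 1.

In `Zh(D)` the component ω only passes over, so it has a single color z, and the order in which its
arcs are joined drops out (`GaussDiagram.cocycleInvariant_zh`). Its effect on `D` is to insert
factors U_z^{±1}. The sum for each fixed z is already an invariant. Moving ω across a crossing
replaces the over color y by z ◃ y, which permutes the summation variable (`zhSum_left`). Traces are
cyclic, which settles changes of base point. A trace product is multilinear in its letters, so a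
local move only has to preserve the tensor of its tangle (`zhSum_plug_congr`), with sides of ω
chosen freely inside the tangle. For the third move they are chosen so that ω never enters the
triangle.

For the ωOCC move, an over-passage does not change the color of its strand; hence the conditions on
the colors of letters are the same in either order. -/

theorem trace_prod_of_isRotated {X R : Type*} [Fintype X] [DecidableEq X] [CommRing R]
    {l l' : List (Matrix X X R)} (hl : l.IsRotated l') : l.prod.trace = l'.prod.trace := by
  obtain ⟨k, rfl⟩ := hl
  rw [List.rotate_eq_drop_append_take_mod, List.prod_append, Matrix.trace_mul_comm,
    ← List.prod_append, List.take_append_drop]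

variable {n : ℕ} {L : Type*} [DecidableEq L]

theorem exists_split {words : Fin n → List L} {e : L}
    (h : ∑ i, (words i).countP (· = e) = 1) :
    ∃ i l₁ l₂, words i = l₁ ++ e :: l₂ ∧ e ∉ l₁ ∧ e ∉ l₂ ∧ ∀ j ≠ i, e ∉ words j := by
  have hz : ∀ l : List L, l.countP (· = e) = 0 ↔ e ∉ l := by
    intro l
    simp only [List.countP_eq_zero, decide_eq_true_eq]
    exact ⟨fun H he => H e he rfl, fun H a ha hae => H (hae ▸ ha)⟩
  obtain ⟨i, hi⟩ : ∃ i, (words i).countP (· = e) ≠ 0 := by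
    by_contra! H
    simp [H] at h
  have hsum := Finset.add_sum_erase Finset.univ (fun i => (words i).countP (· = e))
    (Finset.mem_univ i)
  have hmem : e ∈ words i := by
    by_contra H
    exact hi ((hz _).2 H)
  obtain ⟨l₁, l₂, hl⟩ := List.append_of_mem hmem
  have hl' : (words i).countP (· = e) = l₁.countP (· = e) + (l₂.countP (· = e) + 1) := by
    simp [hl, List.countP_append]
  refine ⟨i, l₁, l₂, hl, (hz _).1 (by omega), (hz _).1 (by omega), fun j hj => (hz _).1 ?_⟩
  have : ∑ j ∈ Finset.univ.erase i, (words j).countP (· = e) = 0 := by omega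
  exact Finset.sum_eq_zero_iff.1 this j (by simp [hj])

variable {X R : Type*} [Fintype X] [DecidableEq X] [CommRing R]

/-- The product over the circles of the traces of the matrix words read along them. -/
def traceProd (words : Fin n → List L) (M : L → Matrix X X R) : R :=
  ∏ i, (((words i).map M).prod).trace

omit [Fintype X] [DecidableEq X] [CommRing R] in
theorem map_update_of_notMem {l : List L} {e : L} (h : e ∉ l)
    (m : L → Matrix X X R) (x : Matrix X X R) : l.map (Function.update m e x) = l.map m :=
  List.map_congr_left fun _ ha => Function.update_of_ne (ne_of_mem_of_not_mem ha h) _ _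

/-- The letter `e` occurs once in all the words together, so only one trace involves `x`, and it
does so linearly. This is the source of multilinearity. -/
theorem exists_traceProd_update {words : Fin n → List L} {e : L}
    (h : ∑ i, (words i).countP (· = e) = 1) (m : L → Matrix X X R) :
    ∃ (c : R) (P Q : Matrix X X R), ∀ x,
      traceProd words (Function.update m e x) = c * (P * x * Q).trace := by
  obtain ⟨i, l₁, l₂, hl, h₁, h₂, h₃⟩ := exists_split h
  refine ⟨∏ j ∈ Finset.univ.erase i, (((words j).map m).prod).trace, (l₁.map m).prod,
    (l₂.map m).prod, fun x => ?_⟩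
  rw [traceProd, ← Finset.prod_erase_mul _ _ (Finset.mem_univ i)]
  congr 1
  · refine Finset.prod_congr rfl fun j hj => ?_
    rw [map_update_of_notMem (h₃ j (Finset.ne_of_mem_erase hj))]
  · rw [hl, List.map_append, List.map_cons, map_update_of_notMem h₁, map_update_of_notMem h₂,
      Function.update_self, List.prod_append, List.prod_cons, mul_assoc]

/-- `traceProd` as a multilinear map, for words in which each letter occurs exactly once. -/
def traceProdMultilinear (words : Fin n → List L)
    (h : ∀ e, ∑ i, (words i).countP (· = e) = 1) :
    MultilinearMap R (fun _ : L => Matrix X X R) R :=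
  MultilinearMap.mk' (traceProd words)
    (fun m e x y => by
      obtain ⟨c, P, Q, H⟩ := exists_traceProd_update (h e) m
      rw [H, H, H, mul_add, add_mul, Matrix.trace_add, mul_add])
    (fun m e r x => by
      obtain ⟨c, P, Q, H⟩ := exists_traceProd_update (h e) m
      rw [H, H, Matrix.mul_smul, Matrix.smul_mul, Matrix.trace_smul, smul_eq_mul, smul_eq_mul,
        mul_left_comm])

variable [Fintype L] {words : Fin n → List L}

theorem traceProd_sum (h : ∀ e, ∑ i, (words i).countP (· = e) = 1)
    {α : L → Type*} [∀ e, Fintype (α e)] (g : ∀ e, α e → Matrix X X R) :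
    traceProd words (fun e => ∑ j, g e j) = ∑ r : ∀ e, α e, traceProd words fun e => g e (r e) :=
  (traceProdMultilinear (X := X) (R := R) words h).map_sum g

theorem traceProd_smul (h : ∀ e, ∑ i, (words i).countP (· = e) = 1)
    (c : L → R) (m : L → Matrix X X R) :
    traceProd words (fun e => c e • m e) = (∏ e, c e) * traceProd words m :=
  (traceProdMultilinear (X := X) (R := R) words h).map_smul_univ c m

/-- Expansion in matrix units separates the entries of the matrices from the way the words connect
them. This makes the state sum local. -/
theorem traceProd_eq_sum_single (h : ∀ e, ∑ i, (words i).countP (· = e) = 1)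
    (M : L → Matrix X X R) :
    traceProd words M = ∑ r : L → X × X, (∏ e, M e (r e).1 (r e).2) *
      traceProd words fun e => Matrix.single (r e).1 (r e).2 1 := by
  have hM : M = fun e => ∑ p : X × X, M e p.1 p.2 • Matrix.single p.1 p.2 (1 : R) := by
    funext e
    conv_lhs => rw [Matrix.matrix_eq_sum_single (M e)]
    simp [Fintype.sum_prod_type]
  conv_lhs => rw [hM]
  rw [traceProd_sum h]
  simp_rw [traceProd_smul h]

end CyclicWords

/-! ### Colorings as colors of letters -/

namespace QuandleTerm

/-- The value of a quandle expression for given values of the generators. -/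
def eval {α : Type} {X : Type*} [Quandle X] (h : α → X) : QuandleTerm α → X
  | of a => h a
  | act x y => eval h x ◃ eval h y
  | invAct x y => eval h x ◃⁻¹ eval h y

theorem Rel.eval_eq {α : Type} {X : Type*} [Quandle X] {r : QuandleTerm α → QuandleTerm α → Prop}
    {h : α → X} (hr : ∀ x y, r x y → x.eval h = y.eval h) {x y : QuandleTerm α}
    (hxy : Rel r x y) : x.eval h = y.eval h := by
  induction hxy with
  | refl x => rfl
  | symm _ ih => exact ih.symm
  | trans _ _ ih₁ ih₂ => exact ih₁.trans ih₂
  | of h => exact hr _ _ h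
  | act _ _ ih₁ ih₂ => simp only [eval, ih₁, ih₂]
  | invAct _ _ ih₁ ih₂ => simp only [eval, ih₁, ih₂]
  | self_distrib x y z => exact Shelf.self_distrib
  | left_inv x y => exact Rack.invAct_act_eq _ _
  | right_inv x y => exact Rack.act_invAct_eq _ _
  | fix x => exact Quandle.fix

end QuandleTerm

/-- The universal property of a quandle given by generators and relations. -/
def PresentedQuandle.lift {α : Type} {X : Type*} [Quandle X]
    {r : QuandleTerm α → QuandleTerm α → Prop} (h : α → X)
    (hr : ∀ x y, r x y → x.eval h = y.eval h) : PresentedQuandle r →◃ X where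
  toFun := Quot.lift (QuandleTerm.eval h) fun _ _ => QuandleTerm.Rel.eval_eq hr
  map_act' := by
    rintro ⟨x⟩ ⟨y⟩
    rfl

/-- The action of `y` or of its inverse, according to the sign `ε`. -/
def signedAct {X : Type*} [Rack X] (ε : ℤˣ) (y x : X) : X := if ε = 1 then y ◃ x else y ◃⁻¹ x

/-- The color with which a strand leaves the letter `e`, if the strands enter the letters with the
colors `v`. -/
def outColor {C X : Type*} [Rack X] (sign : C → ℤˣ) (v : C × Bool → X) (e : C × Bool) : X :=
  if e.2 then v e else signedAct (sign e.1) (v (e.1, true)) (v e)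

namespace GaussDiagram

variable {n : ℕ}

theorem letter_injective (D : GaussDiagram n) : Function.Injective D.letter := by
  rintro ⟨i, k⟩ ⟨j, l⟩ h
  obtain ⟨i₀, l₁, l₂, hl, h₁, h₂, h₃⟩ := CyclicWords.exists_split (D.valid (D.letter ⟨i, k⟩))
  have hi : i = i₀ := by
    by_contra H
    exact h₃ i H (List.get_mem _ _)
  have hj : j = i₀ := by
    by_contra H
    refine h₃ j H ?_
    rw [h]
    exact List.get_mem _ _
  subst hj
  subst hi
  congr 1
  -- The splitting leaves `l₁.length` as the only index at which this letter can stand.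
  have key : ∀ m : Fin (D.words i).length, (D.words i).get m = D.letter ⟨i, k⟩ →
      (m : ℕ) = l₁.length := by
    generalize D.letter ⟨i, k⟩ = e at *
    rintro ⟨m, hm⟩ hme
    simp only [List.get_eq_getElem, hl] at hme
    rcases lt_trichotomy m l₁.length with H | H | H
    · rw [List.getElem_append_left H] at hme
      exact absurd (hme ▸ List.getElem_mem H) h₁
    · exact H
    · rw [List.getElem_append_right H.le] at hme
      obtain ⟨p, hp⟩ : ∃ p, m - l₁.length = p + 1 := ⟨m - l₁.length - 1, by omega⟩
      simp only [hp, List.getElem_cons_succ] at hme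
      exact absurd (hme ▸ List.getElem_mem _) h₂
  exact Fin.ext ((key k rfl).trans (key l h.symm).symm)

theorem letter_pos (D : GaussDiagram n) (e : D.Arrow × Bool) : D.letter (D.pos e) = e :=
  (D.exists_pos e).choose_spec

theorem pos_letter (D : GaussDiagram n) (p : D.Pos) : D.pos (D.letter p) = p :=
  D.letter_injective (D.letter_pos _)

end GaussDiagram

/-- The strand that reads the word `l` starts with the color `s` and ends with the color `t`, if it
enters and leaves each letter `e` with the colors `v e` and `w e`. -/
def ColorPath {L X : Type*} (v w : L → X) : List L → X → X → Prop
  | [], s, t => s = t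
  | e :: l, s, t => s = v e ∧ ColorPath v w l (w e) t

namespace ColorPath

variable {L X : Type*} {v w : L → X}

theorem append_iff {l₁ l₂ : List L} {s t : X} :
    ColorPath v w (l₁ ++ l₂) s t ↔ ∃ m, ColorPath v w l₁ s m ∧ ColorPath v w l₂ m t := by
  induction l₁ generalizing s with
  | nil => simp [ColorPath]
  | cons e l ih => simp [ColorPath, ih, and_assoc]

theorem iff_exists_colors {l : List L} {s t : X} : ColorPath v w l s t ↔
    ∃ c : ℕ → X, c 0 = s ∧ c l.length = t ∧
      ∀ k (hk : k < l.length), v l[k] = c k ∧ w l[k] = c (k + 1) := by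
  induction l generalizing s with
  | nil =>
    constructor
    · rintro rfl
      exact ⟨fun _ => s, by simp⟩
    · rintro ⟨c, rfl, rfl, -⟩
      rfl
  | cons e l ih =>
    rw [ColorPath, ih]
    constructor
    · rintro ⟨rfl, c, hc₀, hc₁, hc⟩
      refine ⟨fun k => Nat.casesOn k (v e) c, rfl, hc₁, ?_⟩
      rintro (_ | k) hk
      · exact ⟨rfl, hc₀.symm⟩
      · exact hc k (by simpa using hk)
    · rintro ⟨c, rfl, rfl, hc⟩
      refine ⟨(hc 0 (by simp)).1.symm, fun k => c (k + 1), (hc 0 (by simp)).2.symm, by simp,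
        fun k hk => ?_⟩
      exact hc (k + 1) (by simpa using hk)

end ColorPath

namespace GaussDiagram

variable {n : ℕ} {X : Type*} [Quandle X]

/-- Colorings in terms of the colors with which the strands enter the letters, and of the colors of
the base points. -/
abbrev LetterColoring {C : Type*} (sign : C → ℤˣ) (words : Fin n → List (C × Bool)) (X : Type*)
    [Quandle X] : Type _ :=
  {p : (C × Bool → X) × (Fin n → X) //
    ∀ i, ColorPath p.1 (outColor sign p.1) (words i) (p.2 i) (p.2 i)}

/-- The color of a short arc. -/
def Coloring.color {D : GaussDiagram n} (χ : D.Coloring X) (s : D.ShortArc) : X :=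
  χ (.of (Quot.mk _ s))

/-- The color with which the letter `e` is entered. -/
noncomputable def Coloring.inColor {D : GaussDiagram n} (χ : D.Coloring X) (e : D.Arrow × Bool) :
    X := χ.color (D.before (D.pos e))

theorem Coloring.color_before {D : GaussDiagram n} (χ : D.Coloring X) (p : D.Pos) :
    χ.color (D.before p) = χ.inColor (D.letter p) := by
  rw [inColor, pos_letter]

theorem Coloring.color_after {D : GaussDiagram n} (χ : D.Coloring X) (p : D.Pos) :
    χ.color (D.after p) = outColor D.sign χ.inColor (D.letter p) := by
  rcases h : D.letter p with ⟨c, _ | _⟩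
  · have hp : D.pos (c, false) = p := by rw [← h, pos_letter]
    simp only [outColor, signedAct, Bool.false_eq_true, if_false]
    rcases Int.units_eq_one_or (D.sign c) with hc | hc
    · rw [if_pos hc]
      have := congrArg χ (Quot.sound (QuandleTerm.Rel.of (CrossingRel.positive c hc)))
      have hmap : χ (.of (D.overArc c) ◃ .of (D.inArc c)) = _ := χ.map_act
      refine Eq.trans ?_ (this.symm.trans hmap)
      rw [← hp]
      rfl
    · rw [if_neg (by rw [hc]; decide)]
      have := congrArg χ (Quot.sound (QuandleTerm.Rel.of (CrossingRel.negative c hc)))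
      have hmap : χ (.of (D.overArc c) ◃ .of (D.outArc c)) = _ := χ.map_act
      have h' := hmap.symm.trans this
      have h'' : χ.inColor (c, true) ◃ χ.color (D.after p) = χ.inColor (c, false) := by
        rw [← hp]
        exact h'
      rw [← h'', Rack.invAct_act_eq]
  · simp only [outColor, if_true]
    rw [← h, ← color_before]
    exact (congrArg (fun a => χ (.of a)) (Quot.sound ⟨p, by rw [h], rfl, rfl⟩)).symm

/-- The colors of letters and base points of a coloring. -/
noncomputable def Coloring.toLetterColoring {D : GaussDiagram n} (χ : D.Coloring X) :
    LetterColoring D.sign D.words X :=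
  ⟨(χ.inColor, fun i => χ.color ⟨i, 0, by simp⟩), fun i => by
    rw [ColorPath.iff_exists_colors]
    have key : ∀ {a b : ℕ} (ha : a < max 1 (D.words i).length)
        (hb : b < max 1 (D.words i).length), a = b → χ.color ⟨i, a, ha⟩ = χ.color ⟨i, b, hb⟩ := by
      rintro a _ _ _ rfl
      rfl
    -- Reduction modulo the number of short arcs closes the circle up; the `max 1` leaves one color
    -- on a circle without letters.
    refine ⟨fun k => χ.color ⟨i, k % max 1 (D.words i).length, Nat.mod_lt _ (by simp)⟩,
      key _ _ (by simp), key _ _ ?_, fun k hk => ?_⟩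
    · rcases Nat.eq_zero_or_pos (D.words i).length with h | h
      · simp [h]
      · rw [max_eq_right h, Nat.mod_self]
    · have hmax : max 1 (D.words i).length = (D.words i).length := max_eq_right (by omega)
      refine ⟨(χ.color_before ⟨i, k, hk⟩).symm.trans (key _ _ ?_),
        (χ.color_after ⟨i, k, hk⟩).symm.trans (key _ _ ?_)⟩
      · rw [hmax, Nat.mod_eq_of_lt hk]
      · rw [hmax]⟩

theorem Coloring.toLetterColoring_bijective {D : GaussDiagram n} :
    Function.Bijective (Coloring.toLetterColoring : D.Coloring X → LetterColoring D.sign D.words X) := by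
  constructor
  · intro χ ψ h
    have h₁ : χ.inColor = ψ.inColor := congrArg (fun p => p.1.1) h
    have h₂ : (fun i => χ.color ⟨i, 0, by simp⟩) = fun i => ψ.color ⟨i, 0, by simp⟩ :=
      congrArg (fun p => p.1.2) h
    refine PresentedQuandle.hom_ext ?_
    rintro ⟨i, k, hk⟩
    change χ.color ⟨i, k, hk⟩ = ψ.color ⟨i, k, hk⟩
    rcases Nat.lt_or_ge k (D.words i).length with hk' | hk'
    · exact (χ.color_before ⟨i, k, hk'⟩).trans
        ((congrFun h₁ _).trans (ψ.color_before ⟨i, k, hk'⟩).symm)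
    -- Here the circle has no letters, so its only short arc is recorded by the base point color
    -- alone.
    · obtain rfl : k = 0 := by omega
      exact congrFun h₂ i
  · rintro ⟨⟨v, x⟩, hp⟩
    simp only [ColorPath.iff_exists_colors] at hp
    choose c hc₀ hc₁ hc using hp
    have hafter : ∀ p : D.Pos, c p.1 ((p.2 + 1) % (D.words p.1).length) =
        outColor D.sign v (D.letter p) := by
      rintro ⟨i, k, hk⟩
      refine Eq.trans ?_ (hc i k hk).2.symm
      rcases Nat.lt_or_ge (k + 1) (D.words i).length with h | h
      · simp only [Nat.mod_eq_of_lt h]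
      -- At the last letter the index wraps around to 0, and the closing condition of the path
      -- identifies the two colors.
      · obtain rfl' : k + 1 = (D.words i).length := by omega
        simp only [rfl', Nat.mod_self, hc₀, hc₁]
    -- The colors of short arcs descend to arcs because `outColor` is the incoming color at an
    -- over-passage.
    let g : D.Arc → X := Quot.lift (fun s => c s.1 s.2) (by
      rintro _ _ ⟨p, hp, rfl, rfl⟩
      refine Eq.trans ?_ (hafter p).symm
      rw [outColor, if_pos hp]
      exact (hc p.1 p.2 p.2.2).1.symm)
    have hin : ∀ e, g (Quot.mk _ (D.before (D.pos e))) = v e := fun e => by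
      conv_rhs => rw [← D.letter_pos e]
      exact (hc (D.pos e).1 (D.pos e).2 (D.pos e).2.2).1.symm
    have hout : ∀ e, g (Quot.mk _ (D.after (D.pos e))) = outColor D.sign v e := fun e => by
      conv_rhs => rw [← D.letter_pos e]
      exact hafter (D.pos e)
    refine ⟨PresentedQuandle.lift g ?_, ?_⟩
    · rintro _ _ (⟨c, h⟩ | ⟨c, h⟩)
      · simp only [QuandleTerm.eval, overArc, inArc, outArc, hin, hout]
        simp [outColor, signedAct, h]
      · simp only [QuandleTerm.eval, overArc, inArc, outArc, hin, hout]
        simp [outColor, signedAct, h, Rack.act_invAct_eq]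
    · refine Subtype.ext (Prod.ext (funext hin) (funext hc₀))

/-- Colorings are the same as colorings of letters and base points. -/
noncomputable def coloringEquiv (D : GaussDiagram n) (X : Type*) [Quandle X] :
    D.Coloring X ≃ LetterColoring D.sign D.words X :=
  Equiv.ofBijective _ Coloring.toLetterColoring_bijective

variable {A : Type*} [CommGroup A]

/-- The Boltzmann weight of a crossing in terms of the colors of the letters. -/
def letterWeight {C : Type*} (sign : C → ℤˣ) (φ : X → X → A) (v : C × Bool → X) (c : C) : A :=
  if sign c = 1 then φ (v (c, false)) (v (c, true))
  else (φ (outColor sign v (c, false)) (v (c, true)))⁻¹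

theorem boltzmannWeight_eq (D : GaussDiagram n) (φ : X → X → A) (χ : D.Coloring X) (c : D.Arrow) :
    D.boltzmannWeight φ χ c = letterWeight D.sign φ (D.coloringEquiv X χ).1.1 c := by
  have h := χ.color_after (D.pos (c, false))
  rw [letter_pos] at h
  have h' : χ (.of (D.outArc c)) = outColor D.sign χ.inColor (c, false) := h
  rw [boltzmannWeight, h']
  rfl

/-! ### The `ω`-over-crossings-commute move -/

-- On the slot carrying the two over-passages, both orders express that `s`, `m` and the two letter
-- colors coincide.
omit [Quandle X] in
theorem colorPath_overPair_iff (T : GaussTemplate n 3) (ε : Fin 2 → ℤˣ)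
    (v w : (T.Arrow ⊕ Fin 2) × Bool → X) (hvw : ∀ c, w (c, true) = v (c, true))
    (l : List ((T.Arrow × Bool) ⊕ Fin 3)) (s t : X) :
    ColorPath v w (l.flatMap (T.fill (.overPair ε false))) s t ↔
      ColorPath v w (l.flatMap (T.fill (.overPair ε true))) s t := by
  induction l generalizing s with
  | nil => rfl
  | cons a l ih =>
    refine ColorPath.append_iff.trans
      ((exists_congr fun m => and_congr ?_ (ih m)).trans ColorPath.append_iff.symm)
    rcases a with e | j
    · rfl
    · fin_cases j
      · change (s = v (Sum.inr 0, true) ∧ w (Sum.inr 0, true) = v (Sum.inr 1, true) ∧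
            w (Sum.inr 1, true) = m) ↔
          (s = v (Sum.inr 1, true) ∧ w (Sum.inr 1, true) = v (Sum.inr 0, true) ∧
            w (Sum.inr 0, true) = m)
        simp only [hvw]
        grind
      · rfl
      · rfl

theorem exists_equiv_overPair (T : GaussTemplate n 3) (ε : Fin 2 → ℤˣ) (φ : X → X → A) :
    ∃ f : (T.plug (.overPair ε false)).Coloring X ≃ (T.plug (.overPair ε true)).Coloring X,
      ∀ χ c, (T.plug (.overPair ε true)).boltzmannWeight φ (f χ) c =
        (T.plug (.overPair ε false)).boltzmannWeight φ χ c := by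
  let e : LetterColoring (Sum.elim T.sign ε)
        (fun i => (T.words i).flatMap (T.fill (.overPair ε false))) X ≃
      LetterColoring (Sum.elim T.sign ε)
        (fun i => (T.words i).flatMap (T.fill (.overPair ε true))) X :=
    -- The bijection is the identity on colors of letters and base points, and the weights depend on
    -- these colors only.
    Equiv.subtypeEquivRight fun p => forall_congr' fun i =>
      colorPath_overPair_iff T ε p.1 (outColor _ p.1) (fun _ => rfl) (T.words i) _ _
  refine ⟨(coloringEquiv (T.plug (.overPair ε false)) X).trans
    (e.trans (coloringEquiv (T.plug (.overPair ε true)) X).symm), fun χ c => ?_⟩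
  refine (boltzmannWeight_eq _ φ _ c).trans (Eq.trans ?_ (boltzmannWeight_eq _ φ χ c).symm)
  refine congrArg (fun p => letterWeight (Sum.elim T.sign ε) φ p.1.1 c)
    (Equiv.apply_symm_apply (coloringEquiv (T.plug (.overPair ε true)) X)
      (e (coloringEquiv (T.plug (.overPair ε false)) X χ)))

end GaussDiagram

/-! ### State sums -/

namespace Matrix

variable {X R : Type*} [DecidableEq X] [CommRing R]

/-- The matrix with the entry `w s` at `(s, f s)` for each `s`, and zeros elsewhere. -/
def monomial (f : X → X) (w : X → R) : Matrix X X R := of fun s t => if t = f s then w s else 0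

theorem monomial_apply (f : X → X) (w : X → R) (s t : X) :
    monomial f w s t = if t = f s then w s else 0 := rfl

theorem monomial_mul [Fintype X] (f g : X → X) (w u : X → R) :
    monomial f w * monomial g u = monomial (fun s => g (f s)) fun s => w s * u (f s) := by
  ext s t
  rw [mul_apply, Finset.sum_eq_single (f s)]
  · simp [monomial_apply]
  · intro j _ hj
    simp [monomial_apply, hj]
  · simp

theorem monomial_id_one : monomial (fun s => s) (fun _ => 1) = (1 : Matrix X X R) := by
  ext s t
  simp [monomial_apply, one_apply, eq_comm]

/-- The target `f s` is irrelevant where the weight vanishes. The freedom is needed for kinks, where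
a projector leaves one color only. -/
theorem monomial_congr {f g : X → X} {w u : X → R} (h : ∀ s, w s = u s)
    (h' : ∀ s, u s ≠ 0 → f s = g s) : monomial f w = monomial g u := by
  ext s t
  rw [monomial_apply, monomial_apply, h s]
  by_cases hu : u s = 0
  · simp [hu]
  · rw [h' s hu]

theorem monomial_eq_sum [Fintype X] (f : X → X) (w : X → R) :
    monomial f w = ∑ v, w v • single v (f v) 1 := by
  ext s t
  simp [monomial_apply, sum_apply, single_apply, ite_and, eq_comm]

end Matrix

-- A product of matrix units vanishes unless consecutive indices match, that is, unless the outgoing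
-- color at each letter is the incoming color at the next.
open Classical in
theorem prod_map_single_apply {L X R : Type*} [Fintype X] [DecidableEq X] [CommRing R] (v w : L → X)
    (l : List L) (s t : X) :
    (l.map fun e => Matrix.single (v e) (w e) (1 : R)).prod s t =
      if ColorPath v w l s t then 1 else 0 := by
  induction l generalizing s with
  | nil =>
    simp only [List.map_nil, List.prod_nil, Matrix.one_apply, ColorPath]
    congr
  | cons e l ih =>
    rw [List.map_cons, List.prod_cons, Matrix.mul_apply]
    by_cases h : v e = s
    · rw [Finset.sum_eq_single (w e)]
      · simp [ih, ColorPath, h]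
      · intro x _ hx
        simp [hx.symm]
      · simp
    · simp [ColorPath, h, Ne.symm h]

open Classical in
theorem traceProd_single {n : ℕ} {L X R : Type*} [Fintype X] [DecidableEq X] [CommRing R]
    (words : Fin n → List L) (v w : L → X) :
    CyclicWords.traceProd words (fun e => Matrix.single (v e) (w e) (1 : R)) =
      ∑ x : Fin n → X, if ∀ i, ColorPath v w (words i) (x i) (x i) then 1 else 0 := by
  simp only [CyclicWords.traceProd, Matrix.trace, Matrix.diag, prod_map_single_apply]
  rw [Finset.prod_univ_sum, Fintype.piFinset_univ]
  refine Finset.sum_congr rfl fun x _ => ?_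
  rw [Finset.prod_ite_zero]
  simp

section LetterMatrix

variable {X A : Type*} [Quandle X] [DecidableEq X] [CommGroup A]

/-- The weight with which a strand of color `s` passes under a strand of color `y` at a crossing of
sign `ε`. -/
def underWeight (φ : X → X → A) (ε : ℤˣ) (y s : X) : A :=
  if ε = 1 then φ s y else (φ (signedAct ε y s) y)⁻¹

/-- The transfer matrix of a passage over (if `b`) or under (otherwise) at a crossing of sign `ε`
with over-crossing color `y`. -/
noncomputable def letterMatrix (φ : X → X → A) (ε : ℤˣ) (b : Bool) (y : X) :
    Matrix X X (MonoidAlgebra ℤ A) :=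
  .monomial (if b then fun s => s else signedAct ε y)
    (if b then fun s => if s = y then 1 else 0 else fun s => .of ℤ A (underWeight φ ε y s))

end LetterMatrix

namespace GaussDiagram

variable {n : ℕ} {X A : Type*} [Quandle X] [Fintype X] [DecidableEq X] [CommGroup A]

/-- Each transfer matrix is expanded into matrix units indexed by the incoming color `v e`. The
traces of the units count the base point colors that complete `v` to a coloring, and the
coefficients multiply to the Boltzmann weight. -/
theorem cocycleInvariant_eq (D : GaussDiagram n) (φ : X → X → A) :
    D.cocycleInvariant φ = ∑ y : D.Arrow → X, CyclicWords.traceProd D.words fun e =>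
      letterMatrix φ (D.sign e.1) e.2 (y e.1) := by
  classical
  have hL : D.cocycleInvariant φ = ∑ v : D.Arrow × Bool → X, ∑ x : Fin n → X,
      if ∀ i, ColorPath v (outColor D.sign v) (D.words i) (x i) (x i) then
        MonoidAlgebra.of ℤ A (∏ c, letterWeight D.sign φ v c) else 0 := by
    rw [cocycleInvariant, ← Fintype.sum_prod_type'
      (f := fun (v : D.Arrow × Bool → X) (x : Fin n → X) =>
        if ∀ i, ColorPath v (outColor D.sign v) (D.words i) (x i) (x i) then
          MonoidAlgebra.of ℤ A (∏ c, letterWeight D.sign φ v c) else 0), ← Finset.sum_filter]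
    have h₁ : ∑ χ : D.Coloring X, MonoidAlgebra.of ℤ A (∏ c, D.boltzmannWeight φ χ c) =
        ∑ p : LetterColoring D.sign D.words X,
          MonoidAlgebra.of ℤ A (∏ c, letterWeight D.sign φ p.1.1 c) :=
      Fintype.sum_equiv (D.coloringEquiv X) _ _ fun χ => by simp only [boltzmannWeight_eq]
    rw [h₁]
    exact (Finset.sum_subtype (M := MonoidAlgebra ℤ A)
      (p := fun p : (D.Arrow × Bool → X) × (Fin n → X) =>
        ∀ i, ColorPath p.1 (outColor D.sign p.1) (D.words i) (p.2 i) (p.2 i)) _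
      (fun p => by simp) fun p : (D.Arrow × Bool → X) × (Fin n → X) =>
      MonoidAlgebra.of ℤ A (∏ c, letterWeight D.sign φ p.1 c)).symm
  simp only [letterMatrix, Matrix.monomial_eq_sum, CyclicWords.traceProd_sum D.valid,
    CyclicWords.traceProd_smul D.valid]
  rw [hL]
  conv_rhs => rw [Finset.sum_comm]
  refine Finset.sum_congr rfl fun v _ => ?_
  -- The projector at the letter `(c, true)` has coefficient 0 unless `y c` is the color of the
  -- over-crossing strand.
  rw [Finset.sum_eq_single fun c => v (c, true)]
  · have h₁ : (fun e : D.Arrow × Bool => Matrix.single (v e)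
        ((if e.2 = true then fun s => s else signedAct (D.sign e.1) (v (e.1, true))) (v e))
        (1 : MonoidAlgebra ℤ A)) = fun e => Matrix.single (v e) (outColor D.sign v e) 1 := by
      funext ⟨c, b⟩
      cases b <;> rfl
    rw [h₁, traceProd_single, Finset.mul_sum]
    refine Finset.sum_congr rfl fun x _ => ?_
    rw [mul_ite, mul_one, mul_zero]
    congr 1
    rw [map_prod, Fintype.prod_prod_type]
    refine Finset.prod_congr rfl fun c _ => ?_
    simp only [Fintype.prod_bool, if_true, Bool.false_eq_true, if_false, one_mul]
    rfl
  · intro y _ hy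
    obtain ⟨c, hc⟩ := Function.ne_iff.1 hy
    rw [Finset.prod_eq_zero (Finset.mem_univ (c, true)), zero_mul]
    simp [hc.symm]
  · simp

end GaussDiagram

/-! ### Relations between transfer matrices -/

section LetterMatrix

variable {X A : Type*} [Quandle X] [Fintype X] [DecidableEq X] [CommGroup A] (φ : X → X → A)

omit [Fintype X] [DecidableEq X] in
theorem signedAct_one (y x : X) : signedAct 1 y x = y ◃ x := if_pos rfl

omit [Fintype X] [DecidableEq X] in
theorem signedAct_neg_one (y x : X) : signedAct (-1) y x = y ◃⁻¹ x := if_neg (by decide)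

omit [Fintype X] [DecidableEq X] in
theorem signedAct_neg_signedAct (ε : ℤˣ) (y x : X) : signedAct (-ε) y (signedAct ε y x) = x := by
  rcases Int.units_eq_one_or ε with rfl | rfl
  · rw [signedAct_one, signedAct_neg_one, Rack.invAct_act_eq]
  · rw [neg_neg, signedAct_one, signedAct_neg_one, Rack.act_invAct_eq]

omit [Fintype X] [DecidableEq X] in
theorem signedAct_self (ε : ℤˣ) (y : X) : signedAct ε y y = y := by
  rcases Int.units_eq_one_or ε with rfl | rfl
  · rw [signedAct_one, Quandle.fix]
  · rw [signedAct_neg_one, Quandle.fix_inv]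

/-- `signedAct ε y` as a permutation. -/
def signedActEquiv (ε : ℤˣ) (y : X) : X ≃ X where
  toFun := signedAct ε y
  invFun := signedAct (-ε) y
  left_inv := signedAct_neg_signedAct ε y
  right_inv x := by simpa using signedAct_neg_signedAct (-ε) y x

/-- A negative crossing takes its weight at the outgoing color, so it inverts exactly the weight of
the positive crossing passed backwards. -/
theorem under_mul_under_neg (ε : ℤˣ) (y : X) :
    letterMatrix φ ε false y * letterMatrix φ (-ε) false y = 1 := by
  simp only [letterMatrix, Matrix.monomial_mul, Bool.false_eq_true, if_false,
    signedAct_neg_signedAct, ← map_mul]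
  rw [← Matrix.monomial_id_one]
  refine Matrix.monomial_congr (fun s => ?_) fun _ _ => rfl
  rw [← map_one (MonoidAlgebra.of ℤ A)]
  congr 1
  rcases Int.units_eq_one_or ε with rfl | rfl
  · simp [underWeight, signedAct, Rack.invAct_act_eq]
  · simp [underWeight, signedAct]

/-- The transfer matrix of a passage under a positive crossing, as a unit. -/
noncomputable def underUnit (y : X) : (Matrix X X (MonoidAlgebra ℤ A))ˣ where
  val := letterMatrix φ 1 false y
  inv := letterMatrix φ (-1) false y
  val_inv := under_mul_under_neg φ 1 y
  inv_val := under_mul_under_neg φ (-1) y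

variable {φ}

theorem over_mul_under (ε : ℤˣ) (δ : ℤˣ) (x y : X) :
    letterMatrix φ ε true y * letterMatrix φ δ false x =
      letterMatrix φ δ false x * letterMatrix φ ε true (signedAct δ x y) := by
  simp only [letterMatrix, Matrix.monomial_mul, if_true, Bool.false_eq_true, if_false]
  refine Matrix.monomial_congr (fun s => ?_) fun _ _ => rfl
  simp [show signedAct δ x s = signedAct δ x y ↔ s = y from (signedActEquiv δ x).injective.eq_iff]

/-- Over-passage matrices do not depend on the sign, so the sign `1` on the right is only a normal
form. -/
theorem over_mul_over (ε δ : ℤˣ) (x y : X) :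
    letterMatrix φ ε true x * letterMatrix φ δ true y =
      if x = y then letterMatrix φ 1 true x else 0 := by
  simp only [letterMatrix, Matrix.monomial_mul, if_true]
  split_ifs with h
  · subst h
    exact Matrix.monomial_congr (fun s => by simp) fun _ _ => rfl
  · ext s t
    rw [Matrix.monomial_apply, Matrix.zero_apply]
    split_ifs <;> simp_all

theorem sum_over (ε : ℤˣ) : ∑ y, letterMatrix φ ε true y = 1 := by
  ext s t
  simp [letterMatrix, Matrix.sum_apply, Matrix.monomial_apply, Matrix.one_apply, eq_comm]

/-- Equality of the weights is the cocycle condition; equality of the underlying permutations is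
self-distributivity. -/
theorem under_one_mul_under_one (hφ : IsQuandleCocycle φ) (x y : X) :
    letterMatrix φ 1 false y * letterMatrix φ 1 false x =
      letterMatrix φ 1 false x * letterMatrix φ 1 false (x ◃ y) := by
  simp only [letterMatrix, Matrix.monomial_mul, Bool.false_eq_true, if_false, signedAct_one,
    underWeight, if_true, ← map_mul]
  refine Matrix.monomial_congr (fun s => ?_) fun s _ => Shelf.self_distrib
  rw [hφ.cocycle, mul_comm]

/-- The positive case says that U_x conjugates U_y to U_{x ◃ y}; the other signs follow by inverting
units. -/
theorem under_mul_under (hφ : IsQuandleCocycle φ) (ε δ : ℤˣ) (x y : X) :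
    letterMatrix φ ε false y * letterMatrix φ δ false x =
      letterMatrix φ δ false x * letterMatrix φ ε false (signedAct δ x y) := by
  have key : ∀ x y, SemiconjBy (underUnit φ x) (underUnit φ (x ◃ y)) (underUnit φ y) := fun x y =>
    Units.ext (under_one_mul_under_one hφ x y).symm
  have key' : ∀ x y, SemiconjBy (underUnit φ x)⁻¹ (underUnit φ (x ◃⁻¹ y)) (underUnit φ y) := by
    intro x y
    have := (key x (x ◃⁻¹ y)).inv_symm_left
    rwa [Rack.act_invAct_eq] at this
  rcases Int.units_eq_one_or ε with rfl | rfl <;> rcases Int.units_eq_one_or δ with rfl | rfl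
  · rw [signedAct_one]
    exact congrArg Units.val (key x y).eq.symm
  · rw [signedAct_neg_one]
    exact congrArg Units.val (key' x y).eq.symm
  · rw [signedAct_one]
    exact congrArg Units.val (key x y).inv_right.eq.symm
  · rw [signedAct_neg_one]
    exact congrArg Units.val (key' x y).inv_right.eq.symm

/-- On the image of the projector onto `y`, passing under `y` fixes the color and has weight φ(y, y)
= 1. This removes kinks. -/
theorem over_mul_under_self (hφ : IsQuandleCocycle φ) (ε δ : ℤˣ) (y : X) :
    letterMatrix φ ε true y * letterMatrix φ δ false y = letterMatrix φ ε true y := by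
  simp only [letterMatrix, Matrix.monomial_mul, if_true, Bool.false_eq_true, if_false]
  have hw : underWeight φ δ y y = 1 := by simp [underWeight, signedAct_self, hφ.diag]
  refine Matrix.monomial_congr (fun s => ?_) fun s hs => ?_
  · by_cases h : s = y
    · rw [if_pos h, h, hw, map_one, one_mul]
    · rw [if_neg h, zero_mul]
  · by_cases h : s = y
    · rw [h, signedAct_self]
    · simp [h] at hs

theorem under_mul_over_self (hφ : IsQuandleCocycle φ) (ε δ : ℤˣ) (y : X) :
    letterMatrix φ δ false y * letterMatrix φ ε true y = letterMatrix φ ε true y := by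
  have := over_mul_under (φ := φ) ε δ y y
  rw [signedAct_self, over_mul_under_self hφ] at this
  exact this.symm

end LetterMatrix

/-! ### The state sum of `Zh(D)` -/

section Zh

variable {X A : Type*} [Quandle X] [Fintype X] [DecidableEq X] [CommGroup A] (φ : X → X → A)

/-- The transfer matrix of a passage through a crossing after `ω`, with color `z`, has been added on
the left (if `l`) or on the right of the crossing. -/
noncomputable def zhMatrix (z : X) (ε : ℤˣ) (l b : Bool) (y : X) :
    Matrix X X (MonoidAlgebra ℤ A) :=
  if (b == decide (ε = 1)) = l then
    letterMatrix φ (if b == decide (ε = 1) then -1 else 1) false z * letterMatrix φ ε b y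
  else letterMatrix φ ε b y * letterMatrix φ (if b == decide (ε = 1) then -1 else 1) false z

/-- The sum over the colorings of `Zh(D)` in which `ω` has the color `z`. -/
noncomputable def zhSum {n : ℕ} {C : Type*} [Fintype C] [DecidableEq C] (z : X) (sign : C → ℤˣ)
    (words : Fin n → List (C × Bool)) (left : C → Bool) : MonoidAlgebra ℤ A :=
  ∑ y : C → X, CyclicWords.traceProd words fun e =>
    zhMatrix φ z (sign e.1) (left e.1) e.2 (y e.1)

/-- The word of ω is a product of projectors, which vanishes unless they all belong to one color
`z`. The order of the letters plays no role. -/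
theorem trace_prod_over {E : Type*} [Fintype E] [DecidableEq E] {ord : List E} (h : ∀ e, e ∈ ord)
    (ε : E → ℤˣ) (y : E → X) :
    (ord.map fun e => letterMatrix φ (ε e) true (y e)).prod.trace =
      ∑ z, if y = fun _ => z then 1 else 0 := by
  have key : ∀ l : List E, (l.map fun e => letterMatrix φ (ε e) true (y e)).prod =
      Matrix.monomial (fun s => s) fun s => if ∀ e ∈ l, y e = s then 1 else 0 := by
    intro l
    induction l with
    | nil => simp [Matrix.monomial_id_one]
    | cons e l ih =>
      rw [List.map_cons, List.prod_cons, ih, letterMatrix, Matrix.monomial_mul]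
      refine Matrix.monomial_congr (fun s => ?_) fun _ _ => rfl
      by_cases hs : y e = s
      · simp [hs]
      · simp [hs, Ne.symm hs]
  rw [key]
  simp [Matrix.trace, Matrix.monomial_apply, funext_iff, h]

theorem GaussDiagram.cocycleInvariant_zh {n : ℕ} (D : GaussDiagram n) (left : D.Arrow → Bool)
    (ord : List (D.Arrow × Bool)) (hord : ∀ e, ord.countP (· = e) = 1) :
    (D.zh left ord hord).cocycleInvariant φ = ∑ z, zhSum φ z D.sign D.words left := by
  have hmem : ∀ e, e ∈ ord := fun e => by
    have : 0 < ord.countP (· = e) := by rw [hord]; exact one_pos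
    simpa [List.countP_pos_iff] using this
  rw [cocycleInvariant_eq]
  let M (y₁ : D.Arrow → X) (y₂ : D.Arrow × Bool → X)
      (e : (D.Arrow ⊕ D.Arrow × Bool) × Bool) : Matrix X X (MonoidAlgebra ℤ A) :=
    letterMatrix φ (Sum.elim D.sign (fun e => if D.leftToRight e then -1 else 1) e.1) e.2
      (Sum.elim y₁ y₂ e.1)
  have hsplit : ∀ y₁ y₂, CyclicWords.traceProd (D.zh left ord hord).words (M y₁ y₂) =
      (∏ i, ((((D.words i).flatMap (D.zhLetter left)).map (M y₁ y₂)).prod).trace) *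
        ∑ z, if y₂ = fun _ => z then 1 else 0 := by
    intro y₁ y₂
    refine (Fin.prod_univ_castSucc _).trans ?_
    simp only [zh, Fin.snoc_castSucc, Fin.snoc_last]
    congr 1
    rw [List.map_map, ← trace_prod_over φ hmem
      (fun e => if D.leftToRight e then -1 else 1)]
    rfl
  refine (Fintype.sum_equiv (Equiv.sumArrowEquivProdArrow _ _ X) _
    (fun p => CyclicWords.traceProd (D.zh left ord hord).words (M p.1 p.2)) fun y => ?_).trans ?_
  · congr 1
    funext e
    rcases e with ⟨c | c, b⟩ <;> rfl
  rw [Fintype.sum_prod_type]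
  simp only [hsplit, Finset.mul_sum, mul_ite, mul_one, mul_zero]
  simp only [zhSum]
  conv_rhs => rw [Finset.sum_comm]
  refine Finset.sum_congr rfl fun y₁ _ => ?_
  rw [Finset.sum_comm]
  refine Finset.sum_congr rfl fun z _ => ?_
  -- Of all colors at the crossings of ω, only the constant family `z` contributes.
  rw [Finset.sum_ite_eq' Finset.univ (fun _ : D.Arrow × Bool => z), if_pos (Finset.mem_univ _)]
  refine Finset.prod_congr rfl fun i _ => ?_
  congr 1
  induction D.words i with
  | nil => rfl
  | cons e l ih =>
    rw [List.flatMap_cons, List.map_append, List.prod_append, List.map_cons, List.prod_cons, ih]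
    congr 1
    rcases e with ⟨c, b⟩
    by_cases hl : D.leftToRight (c, b) = left c
    · have hl' : (b == decide (D.sign c = 1)) = left c := hl
      simp only [zhLetter, zhMatrix, if_pos hl, if_pos hl', List.map_cons, List.map_nil,
        List.prod_cons, List.prod_nil, mul_one]
      rfl
    · have hl' : ¬ (b == decide (D.sign c = 1)) = left c := hl
      simp only [zhLetter, zhMatrix, if_neg hl, if_neg hl', List.map_cons, List.map_nil,
        List.prod_cons, List.prod_nil, mul_one]
      rfl

variable {φ}

/-- Moving `ω` to the other side of a crossing amounts to a change of the over-crossing color. -/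
theorem zhMatrix_left (hφ : IsQuandleCocycle φ) (z : X) (ε : ℤˣ) (l b : Bool) (y : X) :
    zhMatrix φ z ε l b y = zhMatrix φ z ε false b (if l then z ◃ y else y) := by
  cases l
  · rfl
  have hinv : ∀ w : X, signedAct (-1) z (z ◃ w) = w := fun w => by
    rw [signedAct_neg_one, Rack.invAct_act_eq]
  rcases Int.units_eq_one_or ε with rfl | rfl <;> cases b
  · simpa [zhMatrix, signedAct_one] using under_mul_under hφ 1 1 z y
  · simp [zhMatrix, over_mul_under, hinv]
  · simpa [zhMatrix, hinv] using (under_mul_under hφ (-1) (-1) z (z ◃ y)).symm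
  · simpa [zhMatrix, signedAct_one] using over_mul_under (φ := φ) (-1) 1 z y

/-- Changing sides acts on the over-crossing colors by the permutation z ◃ ·, and these colors are
summed over. -/
theorem zhSum_left (hφ : IsQuandleCocycle φ) {n : ℕ} {C : Type*} [Fintype C] [DecidableEq C] (z : X)
    (sign : C → ℤˣ) (words : Fin n → List (C × Bool)) (left left' : C → Bool) :
    zhSum φ z sign words left = zhSum φ z sign words left' := by
  have key : ∀ left, zhSum φ z sign words left = zhSum φ z sign words fun _ => false := by
    intro left
    refine Fintype.sum_equiv (Equiv.piCongrRight fun c =>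
      if left c then signedActEquiv 1 z else Equiv.refl X) _ _ fun y => ?_
    congr 1
    funext e
    rw [zhMatrix_left hφ]
    congr 1
    simp only [Equiv.piCongrRight_apply, Pi.map_apply]
    split_ifs <;> rfl
  rw [key left, key left']

end Zh

/-! ### Locality of the state sum; the first and second Reidemeister moves -/

section Invariance

variable {X A : Type*} [Quandle X] [Fintype X] [DecidableEq X] [CommGroup A] (φ : X → X → A)

/-- The entries of the sum over the over-crossing colors of the tensor products of the transfer
matrices of the strands of a tangle. -/
noncomputable def tangleTensor {k : ℕ} (z : X) (S : GaussTangle k) (left : S.Arrow → Bool)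
    (r : Fin k → X × X) : MonoidAlgebra ℤ A :=
  ∑ y : S.Arrow → X, ∏ j, ((S.strands j).map fun e =>
    zhMatrix φ z (S.sign e.1) (left e.1) e.2 (y e.1)).prod (r j).1 (r j).2

/-- A slot acts as one letter whose matrix is the product along the inserted strand. After expansion
in matrix units, the tangle enters through `tangleTensor` alone. -/
theorem zhSum_plug {n k : ℕ} (z : X) (T : GaussTemplate n k) (S : GaussTangle k)
    (leftT : T.Arrow → Bool) (left : S.Arrow → Bool) :
    zhSum φ z (T.plug S).sign (T.plug S).words (Sum.elim leftT left) =
      ∑ y : T.Arrow → X, ∑ r : (T.Arrow × Bool) ⊕ Fin k → X × X,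
        (∏ e : T.Arrow × Bool, zhMatrix φ z (T.sign e.1) (leftT e.1) e.2 (y e.1) (r (.inl e)).1
          (r (.inl e)).2) * tangleTensor φ z S left (fun j => r (.inr j)) *
        CyclicWords.traceProd T.words fun e => Matrix.single (r e).1 (r e).2 1 := by
  let N (y₁ : T.Arrow → X) (y₂ : S.Arrow → X) :
      (T.Arrow × Bool) ⊕ Fin k → Matrix X X (MonoidAlgebra ℤ A) :=
    Sum.elim (fun e => zhMatrix φ z (T.sign e.1) (leftT e.1) e.2 (y₁ e.1)) fun j =>
      ((S.strands j).map fun e => zhMatrix φ z (S.sign e.1) (left e.1) e.2 (y₂ e.1)).prod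
  refine (Fintype.sum_equiv (Equiv.sumArrowEquivProdArrow _ _ X) _
    (fun p => CyclicWords.traceProd T.words (N p.1 p.2)) fun y => ?_).trans ?_
  · refine Finset.prod_congr rfl fun i _ => ?_
    congr 1
    change (((T.words i).flatMap (T.fill S)).map _).prod = _
    induction T.words i with
    | nil => rfl
    | cons a l ih =>
      refine (congrArg List.prod List.map_append).trans (List.prod_append.trans
        (Eq.trans (congrArg₂ (· * ·) ?_ ih) List.prod_cons.symm))
      rcases a with e | j
      · exact List.prod_singleton
      · exact congrArg List.prod List.map_map
  · rw [Fintype.sum_prod_type]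
    refine Finset.sum_congr rfl fun y₁ _ => ?_
    simp only [CyclicWords.traceProd_eq_sum_single T.valid (N y₁ _)]
    rw [Finset.sum_comm]
    refine Finset.sum_congr rfl fun r _ => ?_
    rw [← Finset.sum_mul, tangleTensor, Finset.mul_sum]
    congr 1
    refine Finset.sum_congr rfl fun y₂ _ => ?_
    rw [Fintype.prod_sum_type]
    rfl

variable {φ}

/-- Sides can be changed independently in the two diagrams, so it suffices to compare the tensors
for convenient sides within each tangle. -/
theorem zhSum_plug_congr (hφ : IsQuandleCocycle φ) {n k : ℕ} (z : X) (T : GaussTemplate n k)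
    {S S' : GaussTangle k} {left : S.Arrow → Bool} {left' : S'.Arrow → Bool}
    (h : ∀ r, tangleTensor φ z S left r = tangleTensor φ z S' left' r) :
    zhSum φ z (T.plug S).sign (T.plug S).words (fun _ => false) =
      zhSum φ z (T.plug S').sign (T.plug S').words (fun _ => false) := by
  refine (zhSum_left hφ z _ _ _ (Sum.elim (fun _ => false) left)).trans
    ((zhSum_plug φ z T S _ left).trans (Eq.trans ?_ ((zhSum_left hφ z _ _ _
      (Sum.elim (fun _ => false) left')).trans (zhSum_plug φ z T S' _ left')).symm))
  simp only [h]

theorem zhSum_iso {n : ℕ} (z : X) {D D' : GaussDiagram n} (h : D.Iso D') :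
    zhSum φ z D.sign D.words (fun _ => false) = zhSum φ z D'.sign D'.words (fun _ => false) := by
  obtain ⟨f, π, hs, hw⟩ := h
  refine Fintype.sum_equiv (f.arrowCongr (Equiv.refl X)) _ _ fun y => ?_
  refine Fintype.prod_equiv π _ _ fun i => ?_
  rw [← CyclicWords.trace_prod_of_isRotated ((hw i).map _), List.map_map]
  congr 3
  funext e
  simp [hs]

theorem tangleTensor_trivial {k : ℕ} (z : X) (left : (GaussTangle.trivial k).Arrow → Bool)
    (r : Fin k → X × X) :
    tangleTensor φ z (.trivial k) left r =
      ∏ j, (1 : Matrix X X (MonoidAlgebra ℤ A)) (r j).1 (r j).2 :=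
  Fintype.sum_unique (ι := Empty → X) _

theorem tangleTensor_kink (hφ : IsQuandleCocycle φ) (z : X) (ε : ℤˣ) (b : Bool)
    (r : Fin 1 → X × X) :
    tangleTensor φ z (.kink ε b) (fun _ => false) r =
      tangleTensor φ z (.trivial 1) (fun _ => false) r := by
  rw [tangleTensor_trivial]
  have key : ∑ y, zhMatrix φ z ε false b y * zhMatrix φ z ε false (!b) y = 1 := by
    have h₁ := under_mul_under_neg φ 1 z
    have h₂ := under_mul_under_neg φ (-1) z
    rw [neg_neg] at h₂
    -- In two cases the factors of ω meet between the letters and cancel; in the other two they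
    -- conjugate the kink, which sums to 1.
    rcases Int.units_eq_one_or ε with rfl | rfl <;> cases b
    · calc _ = letterMatrix φ 1 false z * (∑ y, letterMatrix φ 1 true y) *
            letterMatrix φ (-1) false z := by
            rw [Finset.mul_sum, Finset.sum_mul]
            refine Finset.sum_congr rfl fun y _ => ?_
            rw [← under_mul_over_self hφ 1 1 y]
            simp [zhMatrix, mul_assoc]
        _ = 1 := by rw [sum_over, mul_one, h₁]
    · rw [← sum_over (φ := φ) (X := X) 1]
      refine Finset.sum_congr rfl fun y _ => ?_
      conv_rhs => rw [← over_mul_under_self hφ 1 1 y, ← one_mul (letterMatrix φ 1 false y), ← h₂]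
      simp [zhMatrix, mul_assoc]
    · rw [← sum_over (φ := φ) (X := X) (-1)]
      refine Finset.sum_congr rfl fun y _ => ?_
      conv_rhs => rw [← under_mul_over_self hφ (-1) (-1) y,
        ← one_mul (letterMatrix φ (-1) true y), ← h₂]
      simp [zhMatrix, mul_assoc]
    · calc _ = letterMatrix φ 1 false z * (∑ y, letterMatrix φ (-1) true y) *
            letterMatrix φ (-1) false z := by
            rw [Finset.mul_sum, Finset.sum_mul]
            refine Finset.sum_congr rfl fun y _ => ?_
            rw [← over_mul_under_self hφ (-1) (-1) y]
            simp [zhMatrix, mul_assoc]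
        _ = 1 := by rw [sum_over, mul_one, h₁]
  rw [Fin.prod_univ_one, ← key, Matrix.sum_apply]
  refine Fintype.sum_equiv (Equiv.funUnique Unit X) _ _ fun y => ?_
  rw [Fin.prod_univ_one]
  simp [GaussTangle.kink]

theorem tangleTensor_bigon (z : X) (ε : ℤˣ) (parallel : Bool)
    (r : Fin 2 → X × X) :
    tangleTensor φ z (.bigon ε parallel) (fun _ => false) r =
      tangleTensor φ z (.trivial 2) (fun _ => false) r := by
  have h₁ := under_mul_under_neg φ 1 z
  have h₂ := under_mul_under_neg φ (-1) z
  rw [neg_neg] at h₂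
  -- The over strand forces the two crossing colors to agree. `P x` is the projector onto `x`,
  -- conjugated by the matrix of ω when ω runs outside the two letters.
  obtain ⟨P, hP, hsum⟩ : ∃ P : X → Matrix X X (MonoidAlgebra ℤ A),
      (∀ x y, zhMatrix φ z ε false true x * zhMatrix φ z (-ε) false true y =
        if x = y then P x else 0) ∧ ∑ x, P x = 1 := by
    rcases Int.units_eq_one_or ε with rfl | rfl
    · refine ⟨letterMatrix φ 1 true, fun x y => ?_, sum_over 1⟩
      rw [← over_mul_over 1 (-1) x y]
      conv_rhs => rw [← one_mul (letterMatrix φ (-1) true y), ← h₂]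
      simp [zhMatrix, mul_assoc]
    · refine ⟨fun x => letterMatrix φ 1 false z * letterMatrix φ 1 true x *
        letterMatrix φ (-1) false z, fun x y => ?_, ?_⟩
      · trans letterMatrix φ 1 false z * (letterMatrix φ (-1) true x * letterMatrix φ 1 true y) *
          letterMatrix φ (-1) false z
        · simp [zhMatrix, mul_assoc]
        · rw [over_mul_over]
          split_ifs
          · rfl
          · simp
      · rw [← Finset.sum_mul, ← Finset.mul_sum, sum_over, mul_one, h₁]
  -- Once the colors agree, the two under-passages are inverse to each other, including the factors
  -- of ω.
  have hunder : ∀ (δ : ℤˣ) (x : X),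
      zhMatrix φ z δ false false x * zhMatrix φ z (-δ) false false x = 1 := by
    intro δ x
    rcases Int.units_eq_one_or δ with rfl | rfl
    · trans letterMatrix φ 1 false z * (letterMatrix φ 1 false x * letterMatrix φ (-1) false x) *
        letterMatrix φ (-1) false z
      · simp [zhMatrix, mul_assoc]
      · rw [under_mul_under_neg, mul_one, h₁]
    · trans letterMatrix φ (-1) false x * (letterMatrix φ (-1) false z * letterMatrix φ 1 false z) *
        letterMatrix φ 1 false x
      · simp [zhMatrix, mul_assoc]
      · have := under_mul_under_neg φ (-1) x
        rw [neg_neg] at this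
        rw [h₂, mul_one, this]
  rw [tangleTensor_trivial, Fin.prod_univ_two]
  trans ∑ p : X × X, if p.1 = p.2 then
      P p.1 (r 0).1 (r 0).2 * (1 : Matrix X X (MonoidAlgebra ℤ A)) (r 1).1 (r 1).2 else 0
  · refine Fintype.sum_equiv (finTwoArrowEquiv X) _ _ fun y => ?_
    have e₀ : (((GaussTangle.bigon ε parallel).strands 0).map fun e => zhMatrix φ z
        ((GaussTangle.bigon ε parallel).sign e.1) false e.2 (y e.1)).prod =
        zhMatrix φ z ε false true (y 0) * zhMatrix φ z (-ε) false true (y 1) := by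
      simp [GaussTangle.bigon]
    have e₁ : y 0 = y 1 → (((GaussTangle.bigon ε parallel).strands 1).map fun e => zhMatrix φ z
        ((GaussTangle.bigon ε parallel).sign e.1) false e.2 (y e.1)).prod = 1 := by
      intro hy
      cases parallel
      · simpa [GaussTangle.bigon, hy] using hunder (-ε) (y 1)
      · simpa [GaussTangle.bigon, hy] using hunder ε (y 1)
    change _ = if y 0 = y 1 then _ else _
    rw [Fin.prod_univ_two, e₀, hP]
    by_cases hy : y 0 = y 1
    · rw [if_pos hy, if_pos hy, e₁ hy]
      rfl
    · rw [if_neg hy, if_neg hy, Matrix.zero_apply, zero_mul]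
  · have h := congrArg (fun M : Matrix X X (MonoidAlgebra ℤ A) => M (r 0).1 (r 0).2) hsum
    rw [Matrix.sum_apply] at h
    rw [Fintype.sum_prod_type, ← h, Finset.sum_mul]
    simp

end Invariance

/-! ### The third Reidemeister move -/

section Triangle

/-- The level of the strand before a letter, when `ω` lowers the level by one where it crosses a
strand from right to left, and raises it where it crosses from left to right. -/
def levelIn (ε : ℤˣ) (b l : Bool) : ℤ :=
  (if l then 1 else 0) + if b == decide (ε = 1) then 0 else -1

/-- The level of the strand after a letter. -/
def levelOut (ε : ℤˣ) (b l : Bool) : ℤ :=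
  (if l then 1 else 0) + if b == decide (ε = 1) then -1 else 0

/-- The sides `l₁, l₂` at two letters of a strand with orientation `o` are such that `ω` does not
pass between the letters, also after the letters and both sides have been exchanged, and this
exchange does not affect the levels of the strand before and after both letters. -/
def SidesMatch (o ε₁ : ℤˣ) (b₁ l₁ : Bool) (ε₂ : ℤˣ) (b₂ l₂ : Bool) : Prop :=
  if o = 1 then
    levelOut ε₁ b₁ l₁ = levelIn ε₂ b₂ l₂ ∧ levelOut ε₂ b₂ (!l₂) = levelIn ε₁ b₁ (!l₁) ∧
      levelIn ε₁ b₁ l₁ = levelIn ε₂ b₂ (!l₂) ∧ levelOut ε₂ b₂ l₂ = levelOut ε₁ b₁ (!l₁)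
  else
    levelOut ε₂ b₂ l₂ = levelIn ε₁ b₁ l₁ ∧ levelOut ε₁ b₁ (!l₁) = levelIn ε₂ b₂ (!l₂) ∧
      levelIn ε₂ b₂ l₂ = levelIn ε₁ b₁ (!l₁) ∧ levelOut ε₁ b₁ l₁ = levelOut ε₂ b₂ (!l₂)

instance SidesMatch.decidable (o ε₁ : ℤˣ) (b₁ l₁ : Bool) (ε₂ : ℤˣ) (b₂ l₂ : Bool) :
    Decidable (SidesMatch o ε₁ b₁ l₁ ε₂ b₂ l₂) := by
  unfold SidesMatch
  infer_instance

/-- A finite check over the signs: ω can be placed at the three crossings so that it avoids the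
sides of the triangle, and opposite sides do the same after the move. The signs are those of
`GaussTangle.triangle`. -/
theorem exists_sidesMatch (s a b c : ℤˣ) : ∃ l₀ l₁ l₂ : Bool,
    SidesMatch a (s * c) true l₀ (s * b) true l₁ ∧ SidesMatch b (s * c) false l₀ (s * a) true l₂ ∧
      SidesMatch c (s * b) false l₁ (s * a) false l₂ := by
  revert s a b c
  decide

/-- The product of `M` and `N`, in the opposite order if the orientation `o` is `-1`. -/
def orientedMul {M : Type*} [Mul M] (o : ℤˣ) (a b : M) : M := if o = 1 then a * b else b * a

theorem prod_map_orient {E : Type} {M : Type*} [Monoid M] (o : ℤˣ) (f : E → M) (a b : E) :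
    ((GaussTangle.orient o [a, b]).map f).prod = orientedMul o (f a) (f b) := by
  unfold GaussTangle.orient orientedMul
  split_ifs <;> simp

variable {X A : Type*} [Quandle X] [Fintype X] [DecidableEq X] [CommGroup A] (φ : X → X → A)

/-- Levels are exponents of the matrix of ω, so the factors between consecutive letters of equal
level telescope. -/
theorem zhMatrix_eq_conj (z : X) (ε : ℤˣ) (l b : Bool) (y : X) :
    zhMatrix φ z ε l b y = (underUnit φ z ^ (-levelIn ε b l)).val * letterMatrix φ ε b y *
      (underUnit φ z ^ levelOut ε b l).val := by
  rcases Int.units_eq_one_or ε with rfl | rfl <;> cases l <;> cases b <;>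
    simp [zhMatrix, levelIn, levelOut, -Matrix.coe_units_inv] <;> rfl

variable {φ}

theorem zhMatrix_mul (z : X) {ε₁ ε₂ : ℤˣ} {l₁ b₁ l₂ b₂ : Bool}
    (h : levelOut ε₁ b₁ l₁ = levelIn ε₂ b₂ l₂) (y₁ y₂ : X) :
    zhMatrix φ z ε₁ l₁ b₁ y₁ * zhMatrix φ z ε₂ l₂ b₂ y₂ =
      (underUnit φ z ^ (-levelIn ε₁ b₁ l₁)).val *
        (letterMatrix φ ε₁ b₁ y₁ * letterMatrix φ ε₂ b₂ y₂) *
        (underUnit φ z ^ levelOut ε₂ b₂ l₂).val := by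
  rw [zhMatrix_eq_conj, zhMatrix_eq_conj, h, zpow_neg _ (levelIn ε₂ b₂ l₂)]
  simp only [mul_assoc, Units.mul_inv_cancel_left]

/-- The same outer factors serve both sides of the move, because the levels at the ends agree. Only
the triangles without ω remain to be compared. -/
theorem SidesMatch.exists_units {o ε₁ ε₂ : ℤˣ} {b₁ l₁ b₂ l₂ : Bool}
    (h : SidesMatch o ε₁ b₁ l₁ ε₂ b₂ l₂) (z : X) :
    ∃ U V : (Matrix X X (MonoidAlgebra ℤ A))ˣ, ∀ y₁ y₂,
      orientedMul o (zhMatrix φ z ε₁ l₁ b₁ y₁) (zhMatrix φ z ε₂ l₂ b₂ y₂) =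
        U.val * orientedMul o (letterMatrix φ ε₁ b₁ y₁) (letterMatrix φ ε₂ b₂ y₂) * V.val ∧
      orientedMul (-o) (zhMatrix φ z ε₁ (!l₁) b₁ y₁) (zhMatrix φ z ε₂ (!l₂) b₂ y₂) =
        U.val * orientedMul (-o) (letterMatrix φ ε₁ b₁ y₁) (letterMatrix φ ε₂ b₂ y₂) * V.val := by
  have hne : (-1 : ℤˣ) ≠ 1 := by decide
  rcases Int.units_eq_one_or o with rfl | rfl
  · rw [SidesMatch, if_pos rfl] at h
    obtain ⟨h₁, h₂, h₃, h₄⟩ := h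
    refine ⟨underUnit φ z ^ (-levelIn ε₁ b₁ l₁), underUnit φ z ^ levelOut ε₂ b₂ l₂,
      fun y₁ y₂ => ⟨?_, ?_⟩⟩
    · simp only [orientedMul, if_true]
      rw [zhMatrix_mul z h₁]
    · simp only [orientedMul, if_neg hne]
      rw [zhMatrix_mul z h₂, h₃, h₄]
  · rw [SidesMatch, if_neg hne] at h
    obtain ⟨h₁, h₂, h₃, h₄⟩ := h
    refine ⟨underUnit φ z ^ (-levelIn ε₂ b₂ l₂), underUnit φ z ^ levelOut ε₁ b₁ l₁,
      fun y₁ y₂ => ⟨?_, ?_⟩⟩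
    · simp only [orientedMul, if_neg hne]
      rw [zhMatrix_mul z h₁]
    · simp only [orientedMul, neg_neg, if_true]
      rw [zhMatrix_mul z h₂, h₃, h₄]

theorem orientedMul_over_over (o ε δ : ℤˣ) (x y : X) :
    orientedMul o (letterMatrix φ ε true x) (letterMatrix φ δ true y) =
      if x = y then letterMatrix φ 1 true x else 0 := by
  unfold orientedMul
  split_ifs with h₁ h₂ h₂ <;> rw [over_mul_over]
  · rw [if_pos h₂]
  · rw [if_neg h₂]
  · rw [if_pos h₂.symm, h₂]
  · rw [if_neg (Ne.symm h₂)]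

/-- Exchanging an under-passage with another passage acts on the color of the latter. This serves
the middle strand (`b = true`) and the bottom strand (`b = false`). -/
theorem orientedMul_under_neg (b : Bool) (hφ : IsQuandleCocycle φ) (o δ ε : ℤˣ) (x y : X) :
    orientedMul (-o) (letterMatrix φ δ false x) (letterMatrix φ ε b (signedAct (-(o * δ)) x y)) =
      orientedMul o (letterMatrix φ δ false x) (letterMatrix φ ε b y) := by
  have hne : (-1 : ℤˣ) ≠ 1 := by decide
  have key : ∀ w, letterMatrix φ ε b w * letterMatrix φ δ false x =
      letterMatrix φ δ false x * letterMatrix φ ε b (signedAct δ x w) := by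
    cases b
    · exact under_mul_under hφ ε δ x
    · exact over_mul_under ε δ x
  rcases Int.units_eq_one_or o with rfl | rfl
  · simp only [orientedMul, if_neg hne, if_true, one_mul]
    rw [key]
    congr 2
    simpa using signedAct_neg_signedAct (-δ) x y
  · simp only [orientedMul, if_neg hne, if_true, neg_neg, neg_mul, one_mul]
    rw [key]

theorem tangleTensor_triangle (hφ : IsQuandleCocycle φ) (z : X) (s : ℤˣ) (o : Fin 3 → ℤˣ) :
    ∃ left : Fin 3 → Bool, ∀ r, tangleTensor φ z (.triangle s o) left r =
      tangleTensor φ z (.triangle (-s) (-o)) (fun c => !left c) r := by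
  obtain ⟨l₀, l₁, l₂, h⟩ := exists_sidesMatch s (o 0) (o 1) (o 2)
  refine ⟨![l₀, l₁, l₂], fun r => ?_⟩
  obtain ⟨U₀, V₀, H₀⟩ := h.1.exists_units (φ := φ) z
  obtain ⟨U₁, V₁, H₁⟩ := h.2.1.exists_units (φ := φ) z
  obtain ⟨U₂, V₂, H₂⟩ := h.2.2.exists_units (φ := φ) z
  -- The move changes only the color of the middle strand at its crossing with the bottom strand, by
  -- the action of the top color with sign `-τ`.
  let τ := s * o 1 * o 2
  let f : (Fin 3 → X) ≃ (Fin 3 → X) :=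
    { toFun := fun y => ![y 0, y 1, signedAct (-τ) (y 0) (y 2)]
      invFun := fun y => ![y 0, y 1, signedAct τ (y 0) (y 2)]
      left_inv := fun y => by
        funext j
        fin_cases j
        · rfl
        · rfl
        · simpa using signedAct_neg_signedAct (-τ) (y 0) (y 2)
      right_inv := fun y => by
        funext j
        fin_cases j
        · rfl
        · rfl
        · simpa using signedAct_neg_signedAct τ (y 0) (y 2) }
  refine Fintype.sum_equiv f _ _ fun y => ?_
  refine (Fin.prod_univ_three _).trans (Eq.trans ?_ (Fin.prod_univ_three _).symm)
  simp only [GaussTangle.triangle, Matrix.cons_val]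
  have hy₀ : f y 0 = y 0 := rfl
  have hy₁ : f y 1 = y 1 := rfl
  have hy₂ : f y 2 = signedAct (-τ) (y 0) (y 2) := rfl
  simp only [prod_map_orient, Matrix.cons_val, Pi.neg_apply, neg_mul_neg]
  rw [(H₀ _ _).1, (H₀ _ _).2, (H₁ _ _).1, (H₁ _ _).2, (H₂ _ _).1, (H₂ _ _).2, hy₀, hy₁, hy₂,
    orientedMul_over_over, orientedMul_over_over]
  -- The top strand forces `y 0 = y 1`; otherwise both terms vanish.
  by_cases hy : y 0 = y 1
  -- The middle and bottom strands must require the same change of `y 2`. They do, since orientation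
  -- times sign under the top strand equals `τ` for both: this is where the sign condition on the
  -- triangle enters.
  · have hτ₁ : τ = o 1 * (s * o 2) := by
      simp only [τ]
      rw [mul_left_comm, mul_assoc]
    have hτ₂ : τ = o 2 * (s * o 1) := mul_comm _ _
    rw [hτ₁, orientedMul_under_neg true hφ, ← hτ₁, hτ₂, hy, orientedMul_under_neg false hφ]
  · rw [if_neg hy]
    simp

end Triangle

/-! ### Virtual equivalence and the conclusion -/

section VirtualEquiv

variable {X A : Type*} [Quandle X] [Fintype X] [DecidableEq X] [CommGroup A] {φ : X → X → A}

namespace GaussDiagram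

theorem Move.zhSum_eq (hφ : IsQuandleCocycle φ) (z : X) {n : ℕ} {D D' : GaussDiagram n}
    (h : Move D D') :
    zhSum φ z D.sign D.words (fun _ => false) = zhSum φ z D'.sign D'.words (fun _ => false) := by
  cases h with
  | iso h => exact zhSum_iso z h
  | omega1 T ε b => exact zhSum_plug_congr hφ z T (tangleTensor_kink hφ z ε b)
  | omega2 T ε parallel => exact zhSum_plug_congr hφ z T (tangleTensor_bigon z ε parallel)
  | omega3 T s o =>
    obtain ⟨left, h⟩ := tangleTensor_triangle hφ z s o
    exact zhSum_plug_congr hφ z T h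

theorem VirtualEquiv.zhSum_eq (hφ : IsQuandleCocycle φ) (z : X) {n : ℕ} {D D' : GaussDiagram n}
    (h : D.VirtualEquiv D') :
    zhSum φ z D.sign D.words (fun _ => false) = zhSum φ z D'.sign D'.words (fun _ => false) := by
  induction h with
  | rel _ _ h => exact h.zhSum_eq hφ z
  | refl => rfl
  | symm _ _ _ ih => exact ih.symm
  | trans _ _ _ _ _ ih₁ ih₂ => exact ih₁.trans ih₂

end GaussDiagram

end VirtualEquiv

theorem mainTheorem9 {X A : Type*} [Quandle X] [Finite X] [CommGroup A] (φ : X → X → A)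
    (hφ : IsQuandleCocycle φ) :
    -- the extended cocycle invariant, with any choices made in the construction of `Zh(D)`,
    -- depends only on the virtual link represented by `D`
    (∀ (n : ℕ) (D₀ D₁ : GaussDiagram n), D₀.VirtualEquiv D₁ →
      ∀ (left₀ : D₀.Arrow → Bool) (ord₀ : List (D₀.Arrow × Bool))
        (hord₀ : ∀ e, ord₀.countP (· = e) = 1)
        (left₁ : D₁.Arrow → Bool) (ord₁ : List (D₁.Arrow × Bool))
        (hord₁ : ∀ e, ord₁.countP (· = e) = 1),
        (D₀.zh left₀ ord₀ hord₀).cocycleInvariant φ =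
          (D₁.zh left₁ ord₁ hord₁).cocycleInvariant φ) ∧
    -- the `ω`-over-crossings-commute move, in which two consecutive over-crossings on the last
    -- component `ω` trade places, preserves the Boltzmann weights and their product
    (∀ (n : ℕ) (T : GaussTemplate (n + 1) 3), Sum.inr 0 ∈ T.words (Fin.last n) →
      ∀ ε : Fin 2 → ℤˣ,
        ∃ f : (T.plug (.overPair ε false)).Coloring X ≃ (T.plug (.overPair ε true)).Coloring X,
          ∀ χ, (∀ c : T.Arrow ⊕ Fin 2,
              (T.plug (.overPair ε true)).boltzmannWeight φ (f χ) c =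
                (T.plug (.overPair ε false)).boltzmannWeight φ χ c) ∧
            ∏ c, (T.plug (.overPair ε true)).boltzmannWeight φ (f χ) c =
              ∏ c, (T.plug (.overPair ε false)).boltzmannWeight φ χ c) := by
  classical
  have := Fintype.ofFinite X
  refine ⟨fun n D₀ D₁ h left₀ ord₀ hord₀ left₁ ord₁ hord₁ => ?_, fun n T _ ε => ?_⟩
  · rw [GaussDiagram.cocycleInvariant_zh, GaussDiagram.cocycleInvariant_zh]
    -- The invariants are compared separately for each color `z` of ω.
    refine Finset.sum_congr rfl fun z _ => ?_
    rw [zhSum_left hφ z _ _ left₀ fun _ => false, zhSum_left hφ z _ _ left₁ fun _ => false]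
    exact h.zhSum_eq hφ z
  · obtain ⟨f, hf⟩ := GaussDiagram.exists_equiv_overPair T ε φ
    exact ⟨f, fun χ => ⟨hf χ, Finset.prod_congr rfl fun c _ => hf χ c⟩⟩
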